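/- **Model.** Consider $n$ queues in discrete time and a finite set $\mathcal M$ of channel states with probability mass function $\psi$. For each $m\in\mathcal M$ let $\mathcal S^{(m)}\subset\mathbb R^n_+$ be a finite nonempty set of feasible service rate vectors such that $x\in\mathcal S^{(m)}$ implies $x-x_ie^{(i)}\in\mathcal S^{(m)}$ for every $i$, and let $\mathcal C=\sum_{m}\psi_m\,\mathrm{ConvexHull}(\mathcal S^{(m)})$ be the capacity region. Write $\mathcal C=\{x\in\mathbb R^n_+:\langle c^{(\ell)},x\rangle\le b^{(\ell)},\ \ell=1,\dots,L\}$ with $L$ minimal, $c^{(\ell)}\ge 0$, $\|c^{(\ell)}\|=1$ and $b^{(\ell)}>0$, and let $\mathcal F^{(\ell)}=\{x\in\mathcal C:\langle c^{(\ell)},x\rangle=b^{(\ell)}\}$. Let $\nu$ be a point of the boundary of $\mathcal C$ such that $(1-\epsilon)\nu$ lies in the interior of $\mathcal C$ for every $\epsilon\in(0,1)$. Let $P=\{\ell:\nu\in\mathcal F^{(\ell)}\}$, and let $\mathcal K$ and $\mathcal H$ be the convex cone and the linear subspace generated by $\{c^{(\ell)}:\ell\in P\}$. For $q\in\mathbb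 R^n$ let $q_{\perp\mathcal K}$ and $q_{\perp\mathcal H}$ be $q$ minus its Euclidean projection on $\mathcal K$ and on $\mathcal H$, respectively. For $\epsilon\in(0,1)$, a generalized switch operating under MaxWeight with parameter $\epsilon$ is a process with queue lengths $q(k)\in\mathbb R^n_+$, arrivals $a(k)$, channel states $M(k)$ and potential service $s(k)$, $k=0,1,\dots$, such that: $(a(k),M(k))$ is independent of the history up to the beginning of slot $k$; the $a(k)$ are identically distributed, with $0\le a_i(k)\le A_{\max}$ almost surely and $E[a(k)]=(1-\epsilon)\nu$; $M(k)$ has law $\psi$; $s(k)\in\arg\max_{x\in\mathcal S^{(M(k))}}\langle q(k),x\rangle$, with ties broken at random; and $q(k+1)=q(k)+a(k)-s(k)+u(k)$, where the unused service is $u_i(k)=s_i(k)-\min\{s_i(k),q_i(k)+a_i(k)\}$. A steady-state queue vector $\bar q^{(\epsilon)}$ is a random vector to which $q(k)$ converges in distribution as $k\to\infty$. **Proposition (state space collapse).** Let $\delta>0$ be such that $\delta\le b^{(\ell)}-\langle c^{(\ell)},\nu\rangle$ for all $\ell\notin P$ if some $\ell\notin P$ exists, and $\delta=1$ otherwise.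 Then for each $t=1,2,\dots$ there is a constant $T_t$, which depends on $t$, $\psi$, the sets $\mathcal S^{(m)}$, $(c^{(\ell)},b^{(\ell)})_{\ell}$, $\nu$, $\delta$ and $A_{\max}$ but not on $\epsilon$, such that for every $\epsilon\in(0,1)$ with $\epsilon<\frac{\delta}{2\|\nu\|}$, every generalized switch operating under MaxWeight with parameter $\epsilon$ and every steady-state queue vector $\bar q^{(\epsilon)}$ of it, the following moments are finite and $$E\big\|\bar q^{(\epsilon)}_{\perp\mathcal H}\big\|^t\le E\big\|\bar q^{(\epsilon)}_{\perp\mathcal K}\big\|^t\le T_t .$$ -/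

import Mathlib

open MeasureTheory ProbabilityTheory Filter Topology

/-- Vectors of `ℝⁿ` with the Euclidean norm and the dot product. -/
abbrev Vec (n : ℕ) : Type := EuclideanSpace ℝ (Fin n)

/-- The service side of a generalized switch with `n` queues and finite set `𝓜` of channel states:
the probability mass function `psi` of the channel state, and the finite set `S m` of feasible
service rate vectors in channel state `m`, which is closed under setting a coordinate to zero. -/
structure GeneralizedSwitch (n : ℕ) (𝓜 : Type*) [Fintype 𝓜] where
  psi : 𝓜 → ℝ
  psi_nonneg : ∀ m, 0 ≤ psi m
  psi_sum : ∑ m, psi m = 1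
  S : 𝓜 → Set (Vec n)
  S_finite : ∀ m, (S m).Finite
  S_nonempty : ∀ m, (S m).Nonempty
  S_nonneg : ∀ m, ∀ x ∈ S m, ∀ i, 0 ≤ x i
  S_proj : ∀ m, ∀ x ∈ S m, ∀ i, x - x i • EuclideanSpace.single i (1 : ℝ) ∈ S m

/-- The capacity region `∑ₘ ψₘ ConvexHull(S m)` (a Minkowski sum). -/
def GeneralizedSwitch.capacityRegion {n : ℕ} {𝓜 : Type*} [Fintype 𝓜]
    (sw : GeneralizedSwitch n 𝓜) : Set (Vec n) :=
  {x | ∃ y : 𝓜 → Vec n, (∀ m, y m ∈ convexHull ℝ (sw.S m)) ∧ x = ∑ m, sw.psi m • y m}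

/-- The points of the nonnegative orthant that satisfy `⟨c ℓ, x⟩ ≤ b ℓ` for all `ℓ`. -/
def orthantPolyhedron {n L : ℕ} (c : Fin L → Vec n) (b : Fin L → ℝ) : Set (Vec n) :=
  {x | (∀ i, 0 ≤ x i) ∧ ∀ ℓ, inner ℝ (c ℓ) x ≤ b ℓ}

/-- `(c, b)` describes `C` inside the nonnegative orthant with the minimum number `L` of
half-spaces, normalized so that `c ℓ ≥ 0`, `‖c ℓ‖ = 1` and `b ℓ > 0`. -/
structure IsFacetDescription {n L : ℕ} (C : Set (Vec n)) (c : Fin L → Vec n) (b : Fin L → ℝ) :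
    Prop where
  eq_polyhedron : C = orthantPolyhedron c b
  minimal : ∀ (L' : ℕ) (c' : Fin L' → Vec n) (b' : Fin L' → ℝ),
    C = orthantPolyhedron c' b' → L ≤ L'
  c_nonneg : ∀ ℓ i, 0 ≤ c ℓ i
  c_norm : ∀ ℓ, ‖c ℓ‖ = 1
  b_pos : ∀ ℓ, 0 < b ℓ

/-- The facet of `C` with normal vector `c` and right-hand side `b`. -/
def facet {n : ℕ} (C : Set (Vec n)) (c : Vec n) (b : ℝ) : Set (Vec n) :=
  {x | x ∈ C ∧ inner ℝ c x = b}

/-- The set `P` of the indices of all facets that contain `ν`. -/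
def activeFacets {n L : ℕ} (C : Set (Vec n)) (c : Fin L → Vec n) (b : Fin L → ℝ) (ν : Vec n) :
    Set (Fin L) :=
  {ℓ | ν ∈ facet C (c ℓ) (b ℓ)}

/-- The cone generated by the vectors `c ℓ`, `ℓ ∈ P`, in the nonnegative orthant. -/
def collapseCone {n L : ℕ} (c : Fin L → Vec n) (P : Set (Fin L)) : Set (Vec n) :=
  {x | (∀ i, 0 ≤ x i) ∧
    ∃ ξ : Fin L → ℝ, (∀ ℓ, 0 ≤ ξ ℓ) ∧ (∀ ℓ, ℓ ∉ P → ξ ℓ = 0) ∧ x = ∑ ℓ, ξ ℓ • c ℓ}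

/-- The linear subspace generated by the vectors `c ℓ`, `ℓ ∈ P`. -/
def collapseSpace {n L : ℕ} (c : Fin L → Vec n) (P : Set (Fin L)) : Submodule ℝ (Vec n) :=
  Submodule.span ℝ (c '' P)

/-- The projection of `x` on `K`: the point of `K` that is nearest to `x` (it exists and is unique
when `K` is nonempty, closed and convex). -/
noncomputable def nearestPoint {n : ℕ} (K : Set (Vec n)) (x : Vec n) : Vec n :=
  Classical.epsilon fun y => y ∈ K ∧ ∀ z ∈ K, ‖x - y‖ ≤ ‖x - z‖

theorem nearestPoint_spec {n : ℕ} {K : Set (Vec n)} (hK : IsClosed K) (hne : K.Nonempty)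
    (x : Vec n) :
    nearestPoint K x ∈ K ∧ ∀ z ∈ K, ‖x - nearestPoint K x‖ ≤ ‖x - z‖ := by
  obtain ⟨y, hy, hxy⟩ := hK.exists_infDist_eq_dist hne x
  refine Classical.epsilon_spec (p := fun y => y ∈ K ∧ ∀ z ∈ K, ‖x - y‖ ≤ ‖x - z‖)
    ⟨y, hy, fun z hz => ?_⟩
  rw [← dist_eq_norm, ← dist_eq_norm, ← hxy]
  exact Metric.infDist_le_dist_of_mem hz

theorem collapseCone_nonempty {n L : ℕ} (c : Fin L → Vec n) (P : Set (Fin L)) :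
    (collapseCone c P).Nonempty :=
  ⟨0, fun _ => le_rfl, 0, fun _ => le_rfl, fun _ _ => rfl, by simp⟩

theorem collapseCone_convex {n L : ℕ} (c : Fin L → Vec n) (P : Set (Fin L)) :
    Convex ℝ (collapseCone c P) := by
  rintro x ⟨hx, ξ, hξ, hξP, rfl⟩ y ⟨hy, η, hη, hηP, rfl⟩ r t hr ht _
  refine ⟨fun i => ?_, fun ℓ => r * ξ ℓ + t * η ℓ, fun ℓ => ?_, fun ℓ hℓ => ?_, ?_⟩
  · have h1 := mul_nonneg hr (hx i)
    have h2 := mul_nonneg ht (hy i)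
    simpa using add_nonneg h1 h2
  · exact add_nonneg (mul_nonneg hr (hξ ℓ)) (mul_nonneg ht (hη ℓ))
  · simp [hξP ℓ hℓ, hηP ℓ hℓ]
  · simp [Finset.smul_sum, Finset.sum_add_distrib, add_smul, mul_smul]

/-- The cone is closed when the vectors `c ℓ` are nonnegative unit vectors. -/
theorem collapseCone_isClosed {n L : ℕ} (c : Fin L → Vec n) (P : Set (Fin L))
    (hc : ∀ ℓ i, 0 ≤ c ℓ i) (hc1 : ∀ ℓ, ‖c ℓ‖ = 1) : IsClosed (collapseCone c P) := by
  have hinner : ∀ ℓ ℓ', 0 ≤ inner ℝ (c ℓ) (c ℓ') := fun ℓ ℓ' => by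
    rw [PiLp.inner_apply]
    exact Finset.sum_nonneg fun i _ => by
      simpa using mul_nonneg (hc ℓ' i) (hc ℓ i)
  have hbound : ∀ ξ : Fin L → ℝ, (∀ ℓ, 0 ≤ ξ ℓ) → ∀ ℓ, ξ ℓ ≤ ‖∑ j, ξ j • c j‖ := by
    intro ξ hξ ℓ
    have h1 : inner ℝ (c ℓ) (∑ j, ξ j • c j) = ∑ j, ξ j * inner ℝ (c ℓ) (c j) := by
      simp [inner_sum, inner_smul_right]
    have h2 : ξ ℓ * inner ℝ (c ℓ) (c ℓ) ≤ ∑ j, ξ j * inner ℝ (c ℓ) (c j) :=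
      Finset.single_le_sum (f := fun j => ξ j * inner ℝ (c ℓ) (c j))
        (fun j _ => mul_nonneg (hξ j) (hinner ℓ j)) (Finset.mem_univ ℓ)
    have h3 := real_inner_le_norm (c ℓ) (∑ j, ξ j • c j)
    rw [real_inner_self_eq_norm_sq, hc1] at h2
    rw [hc1] at h3
    linarith
  refine IsSeqClosed.isClosed fun x y hx hxy => ?_
  obtain ⟨R, hR⟩ := (Metric.isBounded_range_of_tendsto x hxy).exists_norm_le
  let D : Set (Fin L → ℝ) := {ξ | (∀ ℓ, ξ ℓ ∈ Set.Icc 0 R) ∧ ∀ ℓ, ℓ ∉ P → ξ ℓ = 0}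
  have hD : IsCompact D := by
    have h1 : IsCompact (Set.pi Set.univ fun _ : Fin L => Set.Icc (0 : ℝ) R) :=
      isCompact_univ_pi fun _ => isCompact_Icc
    have h2 : IsClosed {ξ : Fin L → ℝ | ∀ ℓ, ℓ ∉ P → ξ ℓ = 0} := by
      simp only [Set.ofPred_forall]
      exact isClosed_iInter fun ℓ => isClosed_iInter fun _ =>
        isClosed_eq (continuous_apply ℓ) continuous_const
    have h3 : D = (Set.pi Set.univ fun _ : Fin L => Set.Icc (0 : ℝ) R) ∩
        {ξ : Fin L → ℝ | ∀ ℓ, ℓ ∉ P → ξ ℓ = 0} := by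
      ext ξ
      exact ⟨fun h => ⟨fun ℓ _ => h.1 ℓ, h.2⟩, fun h => ⟨fun ℓ => h.1 ℓ trivial, h.2⟩⟩
    rw [h3]
    exact h1.inter_right h2
  have hf : Continuous fun ξ : Fin L → ℝ => ∑ ℓ, ξ ℓ • c ℓ := by fun_prop
  have hmem : ∀ k, x k ∈ (fun ξ : Fin L → ℝ => ∑ ℓ, ξ ℓ • c ℓ) '' D := by
    intro k
    obtain ⟨_, ξ, hξ, hξP, hk⟩ := hx k
    refine ⟨ξ, ⟨fun ℓ => ⟨hξ ℓ, (hbound ξ hξ ℓ).trans ?_⟩, hξP⟩, hk.symm⟩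
    rw [← hk]
    exact hR _ ⟨k, rfl⟩
  obtain ⟨ξ, ⟨hξ, hξP⟩, hy⟩ :=
    (hD.image hf).isClosed.mem_of_tendsto hxy (Filter.Eventually.of_forall hmem)
  have hy' : y = ∑ ℓ, ξ ℓ • c ℓ := hy.symm
  refine ⟨fun i => ?_, ξ, fun ℓ => (hξ ℓ).1, hξP, hy'⟩
  rw [hy']
  have : (∑ ℓ, ξ ℓ • c ℓ) i = ∑ ℓ, ξ ℓ * c ℓ i := by simp
  rw [this]
  exact Finset.sum_nonneg fun ℓ _ => mul_nonneg (hξ ℓ).1 (hc ℓ i)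

/-- The component `x - x_{∥K}` of `x` orthogonal to the cone `K`. -/
noncomputable def perpCone {n : ℕ} (K : Set (Vec n)) (x : Vec n) : Vec n :=
  x - nearestPoint K x

/-- The component `x - x_{∥H}` of `x` orthogonal to the subspace `H`. -/
noncomputable def perpSpace {n : ℕ} (H : Submodule ℝ (Vec n)) (x : Vec n) : Vec n :=
  x - H.starProjection x

/-- The unused service: for each queue, the potential service minus the amount actually processed,
which is the smaller of the potential service and the amount available. -/
noncomputable def unusedService {n : ℕ} (q a s : Vec n) : Vec n :=
  WithLp.toLp 2 fun i => s i - min (s i) (q i + a i)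

/-- `q`, `a`, `s`, `ch` are the queue lengths, arrivals, potential service and channel states of
the generalized switch `sw` operating under MaxWeight, with mean arrival rate vector `lam` and
arrivals bounded by `Amax`.  The σ-algebra `ℱ k` is the history up to the beginning of time slot
`k`; arrivals and channel states in slot `k` are independent of it.  Ties in the MaxWeight rule may
be broken in any (random) way. -/
structure IsMaxWeightSwitch {n : ℕ} {𝓜 : Type*} [Fintype 𝓜] [MeasurableSpace 𝓜]
    (sw : GeneralizedSwitch n 𝓜) (Amax : ℝ) (lam : Vec n)
    {Ω : Type*} [mΩ : MeasurableSpace Ω] (μ : Measure Ω) (ℱ : Filtration ℕ mΩ)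
    (q a s : ℕ → Ω → Vec n) (ch : ℕ → Ω → 𝓜) : Prop where
  measurable_q : ∀ k, Measurable[ℱ k] (q k)
  measurable_a : ∀ k, Measurable[ℱ (k + 1)] (a k)
  measurable_s : ∀ k, Measurable[ℱ (k + 1)] (s k)
  measurable_ch : ∀ k, Measurable[ℱ (k + 1)] (ch k)
  indep : ∀ k, Indep (MeasurableSpace.comap (fun ω => (a k ω, ch k ω)) inferInstance) (ℱ k) μ
  identDistrib_a : ∀ k, IdentDistrib (a k) (a 0) μ μ
  bounded_a : ∀ᵐ ω ∂μ, ∀ i, 0 ≤ a 0 ω i ∧ a 0 ω i ≤ Amax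
  mean_a : ∀ i, ∫ ω, a 0 ω i ∂μ = lam i
  law_ch : ∀ k m, μ.real {ω | ch k ω = m} = sw.psi m
  q_zero_nonneg : ∀ᵐ ω ∂μ, ∀ i, 0 ≤ q 0 ω i
  maxWeight : ∀ k, ∀ᵐ ω ∂μ, s k ω ∈ sw.S (ch k ω) ∧
    ∀ x ∈ sw.S (ch k ω), inner ℝ (q k ω) x ≤ inner ℝ (q k ω) (s k ω)
  dynamics : ∀ k, ∀ᵐ ω ∂μ,
    q (k + 1) ω = q k ω + a k ω - s k ω + unusedService (q k ω) (a k ω) (s k ω)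

/-! The Lyapunov function is the distance of `q` to the cone `K`. Write `q = p + w` with `p` the
projection on `K` and `w` the remainder, and let `h(x) = ∑ m, psi m * support m x`, the support
function of the capacity region. MaxWeight attains the maximum in `h(q)`, so the mean increment of
`‖w‖ ^ 2` is at most a constant plus twice `⟨w, λ⟩ - h(q) + h(p)`, where `λ = (1 - ε) • ν`.

Two facts bound this expression. Every point of `K` is maximized over the region at `ν`, so `h(p) ≤
⟨p, ν⟩` (`sum_support_le_of_mem_collapseCone`). The region also contains `ν` pushed a distance `r`
along `w`, where `r` is the smaller of `δ` and the least coordinate of `ν`; hence `h(q) ≥ ⟨q, ν⟩ +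
r‖w‖` (`le_sum_support_of_perpCone`). Together they give drift `(ε‖ν‖ - r)‖w‖`, at most `-(r/2)‖w‖`
when `ε‖ν‖ ≤ r/2`. For larger `ε` the load is bounded away from capacity, and the same argument with
the cone `{0}` bounds the moments of the whole queue vector, hence of `w`.

Bounded increments and negative drift above a level yield geometric decay of an exponential moment
(`integral_indicator_exp_le`). This passes to the limit in distribution and dominates all powers
(`integral_pow_le_of_tendstoInDistribution`). The comparison of the two projections follows from `K
⊆ H`. -/

/-! ### Projection on a closed convex set. -/

theorem inner_sub_nearestPoint_nonpos {n : ℕ} {K : Set (Vec n)} (hK : IsClosed K)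
    (hne : K.Nonempty) (hconv : Convex ℝ K) (x : Vec n) {z : Vec n} (hz : z ∈ K) :
    inner ℝ (perpCone K x) (z - nearestPoint K x) ≤ 0 := by
  obtain ⟨hmem, hmin⟩ := nearestPoint_spec hK hne x
  refine (norm_eq_iInf_iff_real_inner_le_zero hconv hmem).1 ?_ z hz
  have : Nonempty K := hne.to_subtype
  refine le_antisymm (le_ciInf fun w => hmin w w.2) ?_
  exact ciInf_le (f := fun w : K => ‖x - w‖) ⟨0, by rintro _ ⟨w, rfl⟩; positivity⟩
    ⟨_, hmem⟩

theorem nearestPoint_add_perpCone {n : ℕ} (K : Set (Vec n)) (x : Vec n) :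
    nearestPoint K x + perpCone K x = x := by
  simp [perpCone]

/-- Each projection is tested in the variational inequality of the other; Cauchy–Schwarz finishes.
The resulting continuity makes the Lyapunov function measurable and usable under weak convergence.
-/
theorem norm_nearestPoint_sub_le {n : ℕ} {K : Set (Vec n)} (hK : IsClosed K)
    (hne : K.Nonempty) (hconv : Convex ℝ K) (x y : Vec n) :
    ‖nearestPoint K x - nearestPoint K y‖ ≤ ‖x - y‖ := by
  have h1 := inner_sub_nearestPoint_nonpos hK hne hconv x (nearestPoint_spec hK hne y).1
  have h2 := inner_sub_nearestPoint_nonpos hK hne hconv y (nearestPoint_spec hK hne x).1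
  set p := nearestPoint K x
  set p' := nearestPoint K y
  have h3 : inner ℝ (x - y) (p - p') = ‖p - p'‖ ^ 2 - inner ℝ (perpCone K x) (p' - p)
      - inner ℝ (perpCone K y) (p - p') := by
    rw [← real_inner_self_eq_norm_sq]
    simp only [perpCone, inner_sub_left, inner_sub_right]
    ring
  have h4 := real_inner_le_norm (x - y) (p - p')
  by_contra! hlt
  have h5 : 0 < ‖p - p'‖ := (norm_nonneg _).trans_lt hlt
  nlinarith

theorem continuous_nearestPoint {n : ℕ} {K : Set (Vec n)} (hK : IsClosed K)
    (hne : K.Nonempty) (hconv : Convex ℝ K) : Continuous (nearestPoint K) :=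
  (LipschitzWith.of_dist_le_mul (K := 1) fun x y => by
    simpa [dist_eq_norm] using norm_nearestPoint_sub_le hK hne hconv x y).continuous

theorem continuous_perpCone {n : ℕ} {K : Set (Vec n)} (hK : IsClosed K)
    (hne : K.Nonempty) (hconv : Convex ℝ K) : Continuous (perpCone K) :=
  continuous_id.sub (continuous_nearestPoint hK hne hconv)

/-- The old projection is a competitor for the new point, so no formula for the new projection is
needed. -/
theorem norm_perpCone_add_le {n : ℕ} {K : Set (Vec n)} (hK : IsClosed K)
    (hne : K.Nonempty) (x v : Vec n) : ‖perpCone K (x + v)‖ ≤ ‖perpCone K x + v‖ := by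
  have h := (nearestPoint_spec hK hne (x + v)).2 _ (nearestPoint_spec hK hne x).1
  have h2 : perpCone K x + v = x + v - nearestPoint K x := by simp only [perpCone]; abel
  rw [h2]
  exact h

theorem abs_norm_perpCone_add_sub_le {n : ℕ} {K : Set (Vec n)} (hK : IsClosed K)
    (hne : K.Nonempty) (x v : Vec n) :
    |‖perpCone K (x + v)‖ - ‖perpCone K x‖| ≤ ‖v‖ := by
  have h1 := norm_perpCone_add_le hK hne x v
  have h2 := norm_perpCone_add_le hK hne (x + v) (-v)
  rw [add_neg_cancel_right] at h2
  have h3 := norm_add_le (perpCone K x) v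
  have h4 := norm_add_le (perpCone K (x + v)) (-v)
  rw [norm_neg] at h4
  rw [abs_le]
  constructor <;> linarith

theorem norm_perpCone_le_norm {n : ℕ} {K : Set (Vec n)} (hK : IsClosed K)
    (h0 : (0 : Vec n) ∈ K) (x : Vec n) : ‖perpCone K x‖ ≤ ‖x‖ := by
  simpa [perpCone] using (nearestPoint_spec hK ⟨0, h0⟩ x).2 0 h0

theorem perpCone_singleton_zero {n : ℕ} (x : Vec n) : perpCone ({0} : Set (Vec n)) x = x := by
  have h := (nearestPoint_spec (isClosed_singleton (x := (0 : Vec n)))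
    (Set.singleton_nonempty _) x).1
  simp [perpCone, Set.mem_singleton_iff.1 h]

theorem norm_perpSpace_le_norm_sub {n : ℕ} (H : Submodule ℝ (Vec n)) (x : Vec n) {y : Vec n}
    (hy : y ∈ H) : ‖perpSpace H x‖ ≤ ‖x - y‖ := by
  rw [perpSpace, H.starProjection_minimal x]
  exact ciInf_le (f := fun w : H => ‖x - w‖) ⟨0, by rintro _ ⟨w, rfl⟩; positivity⟩ ⟨y, hy⟩

theorem collapseCone_subset_collapseSpace {n L : ℕ} (c : Fin L → Vec n) (P : Set (Fin L)) :
    collapseCone c P ⊆ collapseSpace c P := by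
  rintro x ⟨_, ξ, _, hξP, rfl⟩
  refine Submodule.sum_mem _ fun ℓ _ => ?_
  by_cases hℓ : ℓ ∈ P
  · exact Submodule.smul_mem _ _ (Submodule.subset_span ⟨ℓ, hℓ, rfl⟩)
  · simp [hξP ℓ hℓ]

/-! ### Support functions and the geometry of the capacity region. -/

/-- The maximum of `⟨x, y⟩` over the feasible service rate vectors `y` in channel state `m`. -/
noncomputable def GeneralizedSwitch.support {n : ℕ} {𝓜 : Type*} [Fintype 𝓜]
    (sw : GeneralizedSwitch n 𝓜) (m : 𝓜) (x : Vec n) : ℝ :=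
  (sw.S_finite m).toFinset.sup' ((sw.S_finite m).toFinset_nonempty.2 (sw.S_nonempty m))
    fun y => inner ℝ x y

namespace GeneralizedSwitch

variable {n : ℕ} {𝓜 : Type*} [Fintype 𝓜] (sw : GeneralizedSwitch n 𝓜)

theorem inner_le_support {m : 𝓜} {y : Vec n} (hy : y ∈ sw.S m) (x : Vec n) :
    inner ℝ x y ≤ sw.support m x :=
  Finset.le_sup' (fun y => inner ℝ x y) ((sw.S_finite m).mem_toFinset.2 hy)

theorem exists_inner_eq_support (m : 𝓜) (x : Vec n) :
    ∃ y ∈ sw.S m, sw.support m x = inner ℝ x y := by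
  obtain ⟨y, hy, h⟩ := Finset.exists_mem_eq_sup'
    ((sw.S_finite m).toFinset_nonempty.2 (sw.S_nonempty m)) fun y => (inner ℝ x y : ℝ)
  exact ⟨y, (sw.S_finite m).mem_toFinset.1 hy, h⟩

theorem continuous_support (m : 𝓜) : Continuous (sw.support m) :=
  Continuous.finset_sup'_apply _ fun y _ => by fun_prop

theorem exists_norm_le : ∃ B : ℝ, 0 ≤ B ∧ ∀ m, ∀ x ∈ sw.S m, ‖x‖ ≤ B := by
  have hf : (⋃ m, sw.S m).Finite := Set.finite_iUnion sw.S_finite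
  obtain ⟨B, hB⟩ := hf.isBounded.exists_norm_le
  exact ⟨max B 0, le_max_right _ _, fun m x hx =>
    (hB x (Set.mem_iUnion.2 ⟨m, hx⟩)).trans (le_max_left _ _)⟩

theorem support_sub_le {B : ℝ} (hB : ∀ m, ∀ x ∈ sw.S m, ‖x‖ ≤ B) (m : 𝓜) (x y : Vec n) :
    sw.support m x - sw.support m y ≤ ‖x - y‖ * B := by
  obtain ⟨z, hz, h⟩ := sw.exists_inner_eq_support m x
  have h1 := sw.inner_le_support hz y
  have h2 := real_inner_le_norm (x - y) z
  have h3 := mul_le_mul_of_nonneg_left (hB m z hz) (norm_nonneg (x - y))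
  rw [inner_sub_left] at h2
  linarith

theorem abs_support_sub_le {B : ℝ} (hB : ∀ m, ∀ x ∈ sw.S m, ‖x‖ ≤ B) (m : 𝓜) (x y : Vec n) :
    |sw.support m x - sw.support m y| ≤ ‖x - y‖ * B := by
  have h1 := sw.support_sub_le hB m x y
  have h2 := sw.support_sub_le hB m y x
  rw [norm_sub_rev] at h2
  rw [abs_le]
  constructor <;> linarith

theorem inner_le_sum_support {x : Vec n} (hx : x ∈ sw.capacityRegion) (q : Vec n) :
    inner ℝ q x ≤ ∑ m, sw.psi m * sw.support m q := by
  obtain ⟨y, hy, rfl⟩ := hx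
  rw [inner_sum]
  refine Finset.sum_le_sum fun m _ => ?_
  rw [inner_smul_right]
  refine mul_le_mul_of_nonneg_left ?_ (sw.psi_nonneg m)
  have hconv : Convex ℝ {z : Vec n | inner ℝ q z ≤ sw.support m q} :=
    convex_halfSpace_le (innerSL ℝ q).isLinear _
  exact convexHull_min (fun z hz => sw.inner_le_support hz q) hconv (hy m)

theorem exists_sum_support_eq (q : Vec n) :
    ∃ x ∈ sw.capacityRegion, ∑ m, sw.psi m * sw.support m q = inner ℝ q x := by
  choose y hy h using fun m => sw.exists_inner_eq_support m q
  refine ⟨∑ m, sw.psi m • y m, ⟨y, fun m => subset_convexHull ℝ _ (hy m), rfl⟩, ?_⟩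
  simp [inner_sum, inner_smul_right, h]

end GeneralizedSwitch

/-- The maximum of `⟨x, ·⟩` over the capacity region is attained at `ν` when `x` is in the cone
generated by the normals of the facets that contain `ν`. -/
theorem sum_support_le_of_mem_collapseCone {n L : ℕ} {𝓜 : Type*} [Fintype 𝓜]
    {sw : GeneralizedSwitch n 𝓜} {c : Fin L → Vec n} {b : Fin L → ℝ}
    (hcb : IsFacetDescription sw.capacityRegion c b) {ν x : Vec n}
    (hx : x ∈ collapseCone c (activeFacets sw.capacityRegion c b ν)) :
    ∑ m, sw.psi m * sw.support m x ≤ inner ℝ x ν := by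
  obtain ⟨y, hy, h⟩ := sw.exists_sum_support_eq x
  rw [h]
  obtain ⟨_, ξ, hξ, hξP, rfl⟩ := hx
  simp only [sum_inner, real_inner_smul_left]
  refine Finset.sum_le_sum fun ℓ _ => ?_
  by_cases hℓ : ℓ ∈ activeFacets sw.capacityRegion c b ν
  · rw [hcb.eq_polyhedron] at hy
    rw [hℓ.2]
    exact mul_le_mul_of_nonneg_left (hy.2 ℓ) (hξ ℓ)
  · simp [hξP ℓ hℓ]

/-- Moving from `ν` by `r` in the direction `w` stays feasible: active constraints do not increase
because `w` is in the polar cone, inactive ones have slack at least `r`, and so do the coordinates.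
Testing `q` against the moved point gains `r * ⟨q, w⟩ / ‖w‖ ≥ r * ‖w‖`. -/
theorem le_sum_support_of_perpCone {n L : ℕ} {𝓜 : Type*} [Fintype 𝓜]
    {sw : GeneralizedSwitch n 𝓜} {c : Fin L → Vec n} {b : Fin L → ℝ}
    (hcb : IsFacetDescription sw.capacityRegion c b) {ν : Vec n} (hν : ν ∈ sw.capacityRegion)
    {r : ℝ} (hr : 0 ≤ r) (hrν : ∀ i, r ≤ ν i)
    (hrb : ∀ ℓ, ℓ ∉ activeFacets sw.capacityRegion c b ν → r ≤ b ℓ - inner ℝ (c ℓ) ν)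
    (q : Vec n) :
    inner ℝ q ν + r * ‖perpCone (collapseCone c (activeFacets sw.capacityRegion c b ν)) q‖ ≤
      ∑ m, sw.psi m * sw.support m q := by
  set P := activeFacets sw.capacityRegion c b ν with hP
  set K := collapseCone c P with hKdef
  have hK : IsClosed K := collapseCone_isClosed c P hcb.c_nonneg hcb.c_norm
  have hne : K.Nonempty := collapseCone_nonempty c P
  have hconv : Convex ℝ K := collapseCone_convex c P
  have hvar := fun z (hz : z ∈ K) => inner_sub_nearestPoint_nonpos hK hne hconv q hz
  set w := perpCone K q with hw
  have hp := (nearestPoint_spec hK hne q).1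
  have hdecomp := nearestPoint_add_perpCone K q
  set p := nearestPoint K q
  -- Testing at the apex gives `⟨w, p⟩ ≥ 0`, hence `⟨q, w⟩ ≥ ‖w‖ ^ 2` below.
  have h0 := hvar 0 ⟨fun _ => le_rfl, 0, fun _ => le_rfl, fun _ _ => rfl, by simp⟩
  rw [zero_sub, inner_neg_right] at h0
  by_cases hw0 : w = 0
  · simpa [hw0] using sw.inner_le_sum_support hν q
  have hwpos : 0 < ‖w‖ := norm_pos_iff.2 hw0
  have hcw : ∀ ℓ ∈ P, inner ℝ (c ℓ) w ≤ 0 := by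
    intro ℓ hℓ
    have hmem : p + c ℓ ∈ K := by
      obtain ⟨hp0, ξ, hξ, hξP, hpξ⟩ := hp
      refine ⟨fun i => add_nonneg (hp0 i) (hcb.c_nonneg ℓ i),
        fun j => ξ j + if j = ℓ then 1 else 0, fun j => ?_, fun j hj => ?_, ?_⟩
      · have := hξ j
        positivity
      · have : j ≠ ℓ := fun h => hj (h ▸ hℓ)
        simp [hξP j hj, this]
      · simp [add_smul, Finset.sum_add_distrib, ← hpξ]
    have := hvar _ hmem
    rwa [add_sub_cancel_left, real_inner_comm] at this
  have hmemC : ν + (r / ‖w‖) • w ∈ sw.capacityRegion := by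
    have hν' := hν
    rw [hcb.eq_polyhedron] at hν' ⊢
    refine ⟨fun i => ?_, fun ℓ => ?_⟩
    · have h1 : |w i| ≤ ‖w‖ := by simpa using PiLp.norm_apply_le w i
      have h2 : -‖w‖ ≤ w i := (abs_le.1 h1).1
      have h3 : r / ‖w‖ * (-‖w‖) ≤ r / ‖w‖ * w i := mul_le_mul_of_nonneg_left h2 (by positivity)
      have h4 : r / ‖w‖ * (-‖w‖) = -r := by field_simp
      have := hrν i
      simp only [PiLp.add_apply, PiLp.smul_apply, smul_eq_mul]
      linarith
    · rw [inner_add_right, inner_smul_right]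
      by_cases hℓ : ℓ ∈ P
      · have h1 : r / ‖w‖ * inner ℝ (c ℓ) w ≤ 0 :=
          mul_nonpos_of_nonneg_of_nonpos (by positivity) (hcw ℓ hℓ)
        linarith [hν'.2 ℓ]
      · have h1 := real_inner_le_norm (c ℓ) w
        rw [hcb.c_norm, one_mul] at h1
        have h3 : r / ‖w‖ * inner ℝ (c ℓ) w ≤ r / ‖w‖ * ‖w‖ :=
          mul_le_mul_of_nonneg_left h1 (by positivity)
        have h4 : r / ‖w‖ * ‖w‖ = r := by field_simp
        linarith [hrb ℓ hℓ]
  have hqw : ‖w‖ ^ 2 ≤ inner ℝ q w := by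
    rw [← hdecomp, inner_add_left, real_inner_self_eq_norm_sq, real_inner_comm]
    linarith
  refine le_trans ?_ (sw.inner_le_sum_support hmemC q)
  rw [inner_add_right, inner_smul_right]
  have h1 : r / ‖w‖ * ‖w‖ ^ 2 ≤ r / ‖w‖ * inner ℝ q w :=
    mul_le_mul_of_nonneg_left hqw (by positivity)
  have h2 : r / ‖w‖ * ‖w‖ ^ 2 = r * ‖w‖ := by field_simp
  linarith

/-! ### From drift to moments of the limit. -/

theorem le_geometric_of_le_mul_add {x : ℕ → ℝ} {ρ M : ℝ} (hρ0 : 0 ≤ ρ) (hρ1 : ρ < 1)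
    (hx : ∀ k, x (k + 1) ≤ ρ * x k + M) (hM : 0 ≤ M) (k : ℕ) :
    x k ≤ ρ ^ k * x 0 + M / (1 - ρ) := by
  have h1 : 0 < 1 - ρ := by linarith
  induction k with
  | zero => have := div_nonneg hM h1.le; simpa using this
  | succ k ih =>
    have h2 := mul_le_mul_of_nonneg_left ih hρ0
    have h3 : ρ * (M / (1 - ρ)) + M = M / (1 - ρ) := by field_simp; ring
    calc x (k + 1) ≤ ρ * x k + M := hx k
      _ ≤ ρ * (ρ ^ k * x 0 + M / (1 - ρ)) + M := by linarith
      _ = ρ ^ (k + 1) * x 0 + M / (1 - ρ) := by rw [mul_add, add_assoc, h3]; ring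

/-- A continuous nonnegative function whose truncations have bounded means is integrable. -/
theorem integrable_and_integral_le_of_integral_min_le {Ω : Type*} [MeasurableSpace Ω]
    {μ : Measure Ω} [IsProbabilityMeasure μ] {f : Ω → ℝ} (hf : AEMeasurable f μ)
    (hf0 : ∀ ω, 0 ≤ f ω) {M : ℝ} (hM : ∀ N : ℕ, ∫ ω, min (f ω) N ∂μ ≤ M) :
    Integrable f μ ∧ ∫ ω, f ω ∂μ ≤ M := by
  have hM0 : 0 ≤ M := le_trans (integral_nonneg fun ω => le_min (hf0 ω) (by simp)) (hM 0)
  have hmin : ∀ N : ℕ, AEMeasurable (fun ω => min (f ω) N) μ := fun N => hf.min aemeasurable_const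
  have hint : ∀ N : ℕ, Integrable (fun ω => min (f ω) N) μ := fun N =>
    Integrable.of_bound (hmin N).aestronglyMeasurable (C := N) (ae_of_all _ fun ω => by
      rw [Real.norm_of_nonneg (le_min (hf0 ω) (by positivity))]; exact min_le_right _ _)
  have hle : ∫⁻ ω, ENNReal.ofReal (f ω) ∂μ ≤ ENNReal.ofReal M := by
    have hlim : ∀ ω, liminf (fun N : ℕ => ENNReal.ofReal (min (f ω) N)) atTop
        = ENNReal.ofReal (f ω) := by
      intro ω
      refine Tendsto.liminf_eq ?_
      refine tendsto_const_nhds.congr' ?_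
      obtain ⟨N0, hN0⟩ := exists_nat_ge (f ω)
      filter_upwards [eventually_ge_atTop N0] with N hN
      rw [min_eq_left (hN0.trans (by exact_mod_cast hN))]
    calc ∫⁻ ω, ENNReal.ofReal (f ω) ∂μ
        = ∫⁻ ω, liminf (fun N : ℕ => ENNReal.ofReal (min (f ω) N)) atTop ∂μ := by simp_rw [hlim]
      _ ≤ liminf (fun N : ℕ => ∫⁻ ω, ENNReal.ofReal (min (f ω) N) ∂μ) atTop :=
        lintegral_liminf_le' fun N => (hmin N).ennreal_ofReal
      _ ≤ ENNReal.ofReal M := by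
        refine liminf_le_of_le (by isBoundedDefault) fun c hc => ?_
        obtain ⟨N, hN⟩ := hc.exists
        refine hN.trans ?_
        rw [← ofReal_integral_eq_lintegral_ofReal (hint N)
          (ae_of_all _ fun ω => le_min (hf0 ω) (by positivity))]
        exact ENNReal.ofReal_le_ofReal (hM N)
  have hfi : Integrable f μ := by
    refine ⟨hf.aestronglyMeasurable, ?_⟩
    rw [hasFiniteIntegral_iff_ofReal (ae_of_all _ hf0)]
    exact hle.trans_lt ENNReal.ofReal_lt_top
  refine ⟨hfi, ?_⟩
  rw [← ofReal_integral_eq_lintegral_ofReal hfi (ae_of_all _ hf0)] at hle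
  exact (ENNReal.ofReal_le_ofReal_iff hM0).1 hle

/-- The exponent in the exponential moment bound for a process with drift at most `-η` and
increments at most `D`. -/
noncomputable def driftExponent (D η : ℝ) : ℝ := min (1 / D) (min (η / (2 * D ^ 2)) (1 / η))

theorem ae_indicator_exp_le {Ω : Type*} [MeasurableSpace Ω] {μ : Measure Ω}
    {W : ℕ → Ω → ℝ} {D θ : ℝ} (hθ0 : 0 ≤ θ)
    (hinc : ∀ k, ∀ᵐ ω ∂μ, |W (k + 1) ω - W k ω| ≤ D) (R : ℝ) (k : ℕ) :
    ∀ᵐ ω ∂μ, {ω | W 0 ω ≤ R}.indicator (fun ω => Real.exp (θ * W k ω)) ω ≤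
      Real.exp (θ * (R + k * D)) := by
  have hWB : ∀ᵐ ω ∂μ, W 0 ω ≤ R → W k ω ≤ R + k * D := by
    induction k with
    | zero => exact ae_of_all _ fun ω hω => by simpa using hω
    | succ k ih =>
      filter_upwards [ih, hinc k] with ω h1 h2 hω
      have := h1 hω
      have := (abs_le.1 h2).2
      push_cast
      linarith
  filter_upwards [hWB] with ω h
  by_cases hω : ω ∈ {ω | W 0 ω ≤ R}
  · rw [Set.indicator_of_mem hω]
    exact Real.exp_le_exp.2 (mul_le_mul_of_nonneg_left (h hω) hθ0)
  · rw [Set.indicator_of_notMem hω]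
    positivity

theorem integrable_indicator_exp {Ω : Type*} [MeasurableSpace Ω] {μ : Measure Ω}
    [IsProbabilityMeasure μ] {W : ℕ → Ω → ℝ} {D θ : ℝ} (hθ0 : 0 ≤ θ)
    (hW : ∀ k, Measurable (W k))
    (hinc : ∀ k, ∀ᵐ ω ∂μ, |W (k + 1) ω - W k ω| ≤ D) (R : ℝ) (k : ℕ) :
    Integrable ({ω | W 0 ω ≤ R}.indicator fun ω => Real.exp (θ * W k ω)) μ := by
  refine Integrable.of_bound (Measurable.indicator ((hW k).const_mul θ).exp
    (measurableSet_le (hW 0) measurable_const)).aestronglyMeasurable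
    (Real.exp (θ * (R + k * D))) ?_
  filter_upwards [ae_indicator_exp_le hθ0 hinc R k] with ω h
  rwa [Real.norm_of_nonneg (Set.indicator_nonneg (fun _ _ => (Real.exp_pos _).le) ω)]

/-- Geometric decay of the exponential moments of a process with bounded increments and negative
drift above the level `κ`. -/
theorem integral_indicator_exp_le {Ω : Type*} [mΩ : MeasurableSpace Ω] {μ : Measure Ω}
    [IsProbabilityMeasure μ] {ℱ : Filtration ℕ mΩ} {W : ℕ → Ω → ℝ} {D η κ : ℝ}
    (hD : 0 < D) (hη : 0 < η)
    (hW : ∀ k, Measurable[ℱ k] (W k))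
    (hinc : ∀ k, ∀ᵐ ω ∂μ, |W (k + 1) ω - W k ω| ≤ D)
    (hdrift : ∀ k (g : Ω → ℝ) (C : ℝ), Measurable[ℱ k] g → (∀ ω, 0 ≤ g ω) →
      (∀ᵐ ω ∂μ, g ω ≤ C) → (∀ ω, g ω ≠ 0 → κ < W k ω) →
      ∫ ω, g ω * (W (k + 1) ω - W k ω) ∂μ ≤ -η * ∫ ω, g ω ∂μ)
    (R : ℝ) (k : ℕ) :
    ∫ ω, {ω | W 0 ω ≤ R}.indicator (fun ω => Real.exp (driftExponent D η * W k ω)) ω ∂μ ≤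
      (1 - driftExponent D η * η / 2) ^ k * Real.exp (driftExponent D η * R) +
        Real.exp (driftExponent D η * κ + 1) / (driftExponent D η * η / 2) := by
  set θ := driftExponent D η with hθ
  have hθ0 : 0 < θ := by simp only [hθ, driftExponent]; positivity
  -- The three bounds on `θ` serve, in order, to allow `exp x ≤ 1 + x + x ^ 2`, to absorb the
  -- quadratic term in half of the drift, and to keep the contraction factor nonnegative.
  have hθ1 : θ * D ≤ 1 := by
    have : θ ≤ 1 / D := min_le_left _ _
    rwa [le_div_iff₀ hD] at this
  have hθ2 : θ * D ^ 2 ≤ η / 2 := by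
    have : θ ≤ η / (2 * D ^ 2) := (min_le_right _ _).trans (min_le_left _ _)
    rw [le_div_iff₀ (by positivity)] at this
    linarith
  have hθ3 : θ * η ≤ 1 := by
    have : θ ≤ 1 / η := (min_le_right _ _).trans (min_le_right _ _)
    rwa [le_div_iff₀ hη] at this
  have hθη : 0 < θ * η := by positivity
  -- The initial law may lack exponential moments; restricting to this initial event makes all of
  -- them finite.
  set B : Set Ω := {ω | W 0 ω ≤ R} with hBdef
  have hBk : ∀ k, MeasurableSet[ℱ k] B := fun k =>
    ℱ.mono (Nat.zero_le k) _ (measurableSet_le (hW 0) measurable_const)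
  have hWm : ∀ k, Measurable (W k) := fun k => (hW k).mono (ℱ.le k) le_rfl
  have hXb : ∀ k, ∀ᵐ ω ∂μ, B.indicator (fun ω => Real.exp (θ * W k ω)) ω ≤
      Real.exp (θ * (R + k * D)) := ae_indicator_exp_le hθ0.le hinc R
  have hXi : ∀ k, Integrable (B.indicator fun ω => Real.exp (θ * W k ω)) μ :=
    integrable_indicator_exp hθ0.le hWm hinc R
  have hstep : ∀ k, ∫ ω, B.indicator (fun ω => Real.exp (θ * W (k + 1) ω)) ω ∂μ ≤
      (1 - θ * η / 2) * ∫ ω, B.indicator (fun ω => Real.exp (θ * W k ω)) ω ∂μ +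
        Real.exp (θ * κ + 1) := by
    intro k
    set A : Set Ω := {ω | κ < W k ω} with hA
    have hAk : MeasurableSet[ℱ k] A := measurableSet_lt measurable_const (hW k)
    -- The drift hypothesis tests against weights known at time `k`, in place of conditional
    -- expectations; this is the weight for the exponential.
    set g : Ω → ℝ := (A ∩ B).indicator fun ω => Real.exp (θ * W k ω) with hg
    have hgm : Measurable[ℱ k] g :=
      Measurable.indicator (((hW k).const_mul θ).exp) (hAk.inter (hBk k))
    have hg0 : ∀ ω, 0 ≤ g ω := fun ω => Set.indicator_nonneg (fun _ _ => (Real.exp_pos _).le) ω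
    have hgX : ∀ ω, g ω ≤ B.indicator (fun ω => Real.exp (θ * W k ω)) ω := fun ω =>
      Set.indicator_le_indicator_of_subset Set.inter_subset_right (fun _ => (Real.exp_pos _).le) ω
    have hgb : ∀ᵐ ω ∂μ, g ω ≤ Real.exp (θ * (R + k * D)) := by
      filter_upwards [hXb k] with ω h using (hgX ω).trans h
    have hgi : Integrable g μ :=
      (hXi k).mono' (hgm.mono (ℱ.le k) le_rfl).aestronglyMeasurable
        (ae_of_all _ fun ω => by rw [Real.norm_of_nonneg (hg0 ω)]; exact hgX ω)
    have hd := hdrift k g _ hgm hg0 hgb fun ω h => by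
      by_contra h'
      exact h (Set.indicator_of_notMem (fun hm => h' hm.1) _)
    have hgdi : Integrable (fun ω => g ω * (W (k + 1) ω - W k ω)) μ := by
      refine hgi.mul_bdd (c := D) ((hWm _).sub (hWm _)).aestronglyMeasurable ?_
      filter_upwards [hinc k] with ω h using h
    have hpt : ∀ᵐ ω ∂μ, B.indicator (fun ω => Real.exp (θ * W (k + 1) ω)) ω ≤
        (1 + θ ^ 2 * D ^ 2) * g ω + θ * (g ω * (W (k + 1) ω - W k ω)) + Real.exp (θ * κ + 1) := by
      filter_upwards [hinc k] with ω h
      have hexp := Real.exp_pos (θ * κ + 1)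
      by_cases hωB : ω ∈ B
      · rw [Set.indicator_of_mem hωB]
        by_cases hωA : ω ∈ A
        · have hgω : g ω = Real.exp (θ * W k ω) := Set.indicator_of_mem (Set.mem_inter hωA hωB) _
          set d := W (k + 1) ω - W k ω with hd
          have h1 : |θ * d| ≤ 1 := by
            rw [abs_mul, abs_of_pos hθ0]
            exact (mul_le_mul_of_nonneg_left h hθ0.le).trans hθ1
          have h2 := (abs_le.1 (Real.abs_exp_sub_one_sub_id_le h1)).2
          have h3 : d ^ 2 ≤ D ^ 2 := sq_le_sq' (abs_le.1 h).1 (abs_le.1 h).2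
          have h4 : Real.exp (θ * W (k + 1) ω) = g ω * Real.exp (θ * d) := by
            rw [hgω, ← Real.exp_add, hd]
            ring_nf
          have h5 : θ ^ 2 * d ^ 2 ≤ θ ^ 2 * D ^ 2 := mul_le_mul_of_nonneg_left h3 (sq_nonneg θ)
          have h6 : Real.exp (θ * d) ≤ 1 + θ * d + θ ^ 2 * D ^ 2 := by
            rw [mul_pow] at h2
            linarith
          have h7 := mul_le_mul_of_nonneg_left h6 (hg0 ω)
          rw [h4]
          linarith
        · have hgω : g ω = 0 := Set.indicator_of_notMem (fun hm => hωA hm.1) _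
          rw [hgω]
          have h1 : W k ω ≤ κ := not_lt.1 hωA
          have h2 := (abs_le.1 h).2
          have h3 : θ * W (k + 1) ω ≤ θ * (κ + D) := mul_le_mul_of_nonneg_left (by linarith) hθ0.le
          have : Real.exp (θ * W (k + 1) ω) ≤ Real.exp (θ * κ + 1) :=
            Real.exp_le_exp.2 (by linarith)
          linarith
      · rw [Set.indicator_of_notMem hωB]
        have hgω : g ω = 0 := Set.indicator_of_notMem (fun hm => hωB hm.2) _
        rw [hgω]
        linarith
    have hint := integral_mono_ae (hXi (k + 1)) (((hgi.const_mul _).fun_add (hgdi.const_mul _)).fun_add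
      (integrable_const _)) hpt
    rw [integral_add ((hgi.const_mul _).fun_add (hgdi.const_mul _)) (integrable_const _),
      integral_add (hgi.const_mul _) (hgdi.const_mul _), integral_const_mul, integral_const_mul,
      integral_const] at hint
    simp only [probReal_univ, one_smul] at hint
    have hgle : ∫ ω, g ω ∂μ ≤ ∫ ω, B.indicator (fun ω => Real.exp (θ * W k ω)) ω ∂μ :=
      integral_mono hgi (hXi k) hgX
    have hgnn : 0 ≤ ∫ ω, g ω ∂μ := integral_nonneg hg0
    have h1 : (1 - θ * η / 2) * ∫ ω, g ω ∂μ ≤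
        (1 - θ * η / 2) * ∫ ω, B.indicator (fun ω => Real.exp (θ * W k ω)) ω ∂μ :=
      mul_le_mul_of_nonneg_left hgle (by linarith)
    have h2 := mul_le_mul_of_nonneg_left hd hθ0.le
    have h3 : θ ^ 2 * D ^ 2 * ∫ ω, g ω ∂μ ≤ θ * (η / 2) * ∫ ω, g ω ∂μ := by
      refine mul_le_mul_of_nonneg_right ?_ hgnn
      have := mul_le_mul_of_nonneg_left hθ2 hθ0.le
      linarith
    linarith
  have h := le_geometric_of_le_mul_add
    (x := fun k => ∫ ω, B.indicator (fun ω => Real.exp (θ * W k ω)) ω ∂μ)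
    (ρ := 1 - θ * η / 2) (by linarith) (by linarith) hstep (Real.exp_pos _).le k
  refine h.trans ?_
  rw [sub_sub_cancel]
  gcongr
  · have : 0 ≤ 1 - θ * η / 2 := by linarith
    positivity
  · have := integral_mono_ae (hXi 0) (integrable_const _) (hXb 0)
    simpa using this

/-- Moment bound for the limit in distribution of a process for which a function `V` has bounded
increments and negative drift above the level `κ`. -/
theorem integral_pow_le_of_tendstoInDistribution {E : Type*} [TopologicalSpace E]
    [MeasurableSpace E] [BorelSpace E] {Ω : Type*} [mΩ : MeasurableSpace Ω] {μ : Measure Ω}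
    [IsProbabilityMeasure μ] {ℱ : Filtration ℕ mΩ} {q : ℕ → Ω → E} {V : E → ℝ} {D η κ : ℝ}
    (hD : 0 < D) (hη : 0 < η) (hV : Continuous V) (hV0 : ∀ x, 0 ≤ V x)
    (hq : ∀ k, Measurable[ℱ k] (q k))
    (hinc : ∀ k, ∀ᵐ ω ∂μ, |V (q (k + 1) ω) - V (q k ω)| ≤ D)
    (hdrift : ∀ k (g : Ω → ℝ) (C : ℝ), Measurable[ℱ k] g → (∀ ω, 0 ≤ g ω) →
      (∀ᵐ ω ∂μ, g ω ≤ C) → (∀ ω, g ω ≠ 0 → κ < V (q k ω)) →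
      ∫ ω, g ω * (V (q (k + 1) ω) - V (q k ω)) ∂μ ≤ -η * ∫ ω, g ω ∂μ)
    {Ω' : Type*} [MeasurableSpace Ω'] {μ' : Measure Ω'} [IsProbabilityMeasure μ'] {qbar : Ω' → E}
    (hlim : TendstoInDistribution q atTop qbar (fun _ => μ) μ') (t : ℕ) :
    Integrable (fun ω => V (qbar ω) ^ t) μ' ∧
      ∫ ω, V (qbar ω) ^ t ∂μ' ≤ t.factorial / driftExponent D η ^ t *
        (Real.exp (driftExponent D η * κ + 1) / (driftExponent D η * η / 2)) := by
  have hθ0 : 0 < driftExponent D η := by simp only [driftExponent]; positivity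
  have hθ3 : driftExponent D η * η ≤ 1 := by
    have : driftExponent D η ≤ 1 / η := (min_le_right _ _).trans (min_le_right _ _)
    rwa [le_div_iff₀ hη] at this
  have hexp := integral_indicator_exp_le (W := fun k ω => V (q k ω)) (κ := κ) hD hη
    (fun k => hV.measurable.comp (hq k)) hinc hdrift
  set θ := driftExponent D η
  have hθη : 0 < θ * η := by positivity
  set M := Real.exp (θ * κ + 1) / (θ * η / 2)
  set C0 : ℝ := t.factorial / θ ^ t with hC0
  have hC0pos : 0 ≤ C0 := by positivity
  -- One term of the exponential series dominates the power.
  have hpow : ∀ x, V x ^ t ≤ C0 * Real.exp (θ * V x) := by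
    intro x
    have h := Real.pow_div_factorial_le_exp _ (mul_nonneg hθ0.le (hV0 x)) t
    rw [mul_pow, div_le_iff₀ (by positivity)] at h
    rw [hC0, div_mul_eq_mul_div, le_div_iff₀ (by positivity)]
    linarith
  refine integrable_and_integral_le_of_integral_min_le
    ((hV.pow t).measurable.comp_aemeasurable hlim.aemeasurable_limit)
    (fun ω => pow_nonneg (hV0 _) t) fun N => ?_
  have hfc : Continuous fun x => min (V x ^ t) (N : ℝ) := by fun_prop
  have hf0 : ∀ x, 0 ≤ min (V x ^ t) (N : ℝ) := fun x => le_min (pow_nonneg (hV0 x) t) (by simp)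
  let f : BoundedContinuousFunction E ℝ := BoundedContinuousFunction.ofNormedAddCommGroup _ hfc N
    fun x => by rw [Real.norm_of_nonneg (hf0 x)]; exact min_le_right _ _
  have hconv := ProbabilityMeasure.tendsto_iff_forall_integral_tendsto.1 hlim.tendsto f
  have hqm : ∀ k, Measurable (q k) := fun k => (hq k).mono (ℱ.le k) le_rfl
  have hmap : ∀ k, ∫ x, f x ∂(μ.map (q k)) = ∫ ω, min (V (q k ω) ^ t) (N : ℝ) ∂μ := fun k =>
    integral_map (hqm k).aemeasurable hfc.measurable.aestronglyMeasurable
  have hmap' : ∫ x, f x ∂(μ'.map qbar) = ∫ ω, min (V (qbar ω) ^ t) (N : ℝ) ∂μ' :=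
    integral_map hlim.aemeasurable_limit hfc.measurable.aestronglyMeasurable
  simp only [ProbabilityMeasure.coe_mk] at hconv
  rw [hmap'] at hconv
  simp_rw [hmap] at hconv
  have hB : ∀ R : ℕ, MeasurableSet {ω | V (q 0 ω) ≤ (R : ℝ)} := fun R =>
    measurableSet_le (hV.measurable.comp (hqm 0)) measurable_const
  have hXi : ∀ k (R : ℕ), Integrable
      ({ω | V (q 0 ω) ≤ (R : ℝ)}.indicator fun ω => Real.exp (θ * V (q k ω))) μ := fun k R =>
    integrable_indicator_exp (W := fun k ω => V (q k ω)) hθ0.le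
      (fun k => hV.measurable.comp (hqm k)) hinc R k
  have hfi : ∀ k, Integrable (fun ω => min (V (q k ω) ^ t) (N : ℝ)) μ := fun k =>
    Integrable.of_bound (hfc.measurable.comp (hqm k)).aestronglyMeasurable (C := N)
      (ae_of_all _ fun ω => by rw [Real.norm_of_nonneg (hf0 _)]; exact min_le_right _ _)
  -- For fixed `N` and `R`, let `k → ∞`: the exponential bound applies on the initial event, the
  -- bound `N` off it. Then `R → ∞` removes the last term, and `N` is released at the end by Fatou.
  have hR : ∀ R : ℕ, ∫ ω, min (V (qbar ω) ^ t) (N : ℝ) ∂μ' ≤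
      C0 * M + N * μ.real {ω | V (q 0 ω) ≤ (R : ℝ)}ᶜ := by
    intro R
    set B := {ω | V (q 0 ω) ≤ (R : ℝ)} with hBdef
    have hgeo : Tendsto (fun k : ℕ => (1 - θ * η / 2) ^ k * Real.exp (θ * R)) atTop (𝓝 0) := by
      simpa using (tendsto_pow_atTop_nhds_zero_of_lt_one (r := 1 - θ * η / 2) (by linarith)
        (by linarith)).mul_const (Real.exp (θ * R))
    have hlim2 : Tendsto (fun k : ℕ => C0 * ((1 - θ * η / 2) ^ k * Real.exp (θ * R) + M) +
        N * μ.real Bᶜ) atTop (𝓝 (C0 * M + N * μ.real Bᶜ)) := by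
      simpa using ((hgeo.add_const M).const_mul C0).add_const (N * μ.real Bᶜ)
    refine le_of_tendsto_of_tendsto' hconv hlim2 fun k => ?_
    refine le_trans ?_ (add_le_add (mul_le_mul_of_nonneg_left (hexp R k) hC0pos) le_rfl)
    rw [integral_indicator (hB R), ← integral_add_compl (hB R)]
    · refine add_le_add ?_ ?_
      · rw [← integral_const_mul]
        refine integral_mono_of_nonneg (ae_of_all _ fun ω => hf0 _) ?_
          (ae_of_all _ fun ω => (min_le_left _ _).trans (hpow _))
        exact ((integrable_indicator_iff (hB R)).1 (hXi k R)).const_mul C0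
      · refine (setIntegral_mono_on (g := fun _ => (N : ℝ)) ?_ ?_ (hB R).compl
          fun ω _ => min_le_right _ _).trans ?_
        · exact (hfi k).integrableOn
        · exact integrableOn_const
        · simp [mul_comm, hBdef]
    · exact hfi k
  have hzero : Tendsto (fun R : ℕ => μ.real {ω | V (q 0 ω) ≤ (R : ℝ)}ᶜ) atTop (𝓝 0) := by
    have h := tendsto_measure_iInter_atTop (μ := μ)
      (s := fun R : ℕ => {ω | V (q 0 ω) ≤ (R : ℝ)}ᶜ)
      (fun R => (hB R).compl.nullMeasurableSet) (fun R R' hRR' ω hω hω' =>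
        hω (le_trans (Set.mem_ofPred.1 hω') (by exact_mod_cast hRR'))) ⟨0, measure_ne_top _ _⟩
    have he : ⋂ R : ℕ, {ω | V (q 0 ω) ≤ (R : ℝ)}ᶜ = ∅ := by
      refine Set.eq_empty_iff_forall_notMem.2 fun ω hω => ?_
      obtain ⟨R, hR⟩ := exists_nat_ge (V (q 0 ω))
      exact Set.mem_iInter.1 hω R hR
    rw [he, measure_empty] at h
    exact (ENNReal.tendsto_toReal ENNReal.zero_ne_top).comp h
  refine ge_of_tendsto' (f := fun R : ℕ => C0 * M + N * μ.real {ω | V (q 0 ω) ≤ (R : ℝ)}ᶜ)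
    (x := atTop) ?_ hR
  simpa using (hzero.const_mul (N : ℝ)).const_add (C0 * M)

/-! ### One-step estimates for the queue recursion. -/

theorem norm_le_mul_of_abs_apply_le {n : ℕ} {x : Vec n} {A : ℝ} (hx : ∀ i, |x i| ≤ A) :
    ‖x‖ ≤ n * A := by
  have h := (EuclideanSpace.basisFun (Fin n) ℝ).sum_repr x
  rw [← h]
  refine (norm_sum_le _ _).trans ((Finset.sum_le_sum (g := fun _ => A) fun i _ => ?_).trans ?_)
  · simpa [norm_smul] using hx i
  · simp

section OneStep

variable {n : ℕ} {q a s : Vec n}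

theorem unusedService_nonneg (i : Fin n) : 0 ≤ unusedService q a s i := by
  simp [unusedService]

theorem unusedService_le (hq : ∀ i, 0 ≤ q i) (ha : ∀ i, 0 ≤ a i) (hs : ∀ i, 0 ≤ s i)
    (i : Fin n) : unusedService q a s i ≤ s i := by
  have := hq i
  have := ha i
  simp only [unusedService, sub_le_self_iff, le_min_iff]
  exact ⟨hs i, by linarith⟩

theorem queue_nonneg (i : Fin n) : 0 ≤ (q + a - s + unusedService q a s) i := by
  have := min_le_right (s i) (q i + a i)
  simp only [unusedService, PiLp.add_apply, PiLp.sub_apply]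
  linarith

theorem abs_queue_increment_le {A B : ℝ} (hq : ∀ i, 0 ≤ q i) (ha : ∀ i, 0 ≤ a i ∧ a i ≤ A)
    (hs : ∀ i, 0 ≤ s i) (hsB : ‖s‖ ≤ B) (i : Fin n) :
    |(a - s + unusedService q a s) i| ≤ |A| + B := by
  have h1 := unusedService_nonneg (q := q) (a := a) (s := s) i
  have h2 := unusedService_le hq (fun i => (ha i).1) hs i
  have h3 : |s i| ≤ ‖s‖ := by simpa using PiLp.norm_apply_le s i
  have h4 := le_abs_self (s i)
  have h5 := le_abs_self A
  have h6 := ha i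
  have h7 := hs i
  simp only [PiLp.add_apply, PiLp.sub_apply]
  rw [abs_le]
  constructor <;> linarith

/-- Service is wasted only at a queue shorter than its service rate, so each product is at most `B ^
2`. -/
theorem inner_unusedService_le {B : ℝ} (hq : ∀ i, 0 ≤ q i) (ha : ∀ i, 0 ≤ a i)
    (hs : ∀ i, 0 ≤ s i) (hsB : ‖s‖ ≤ B) : inner ℝ q (unusedService q a s) ≤ n * B ^ 2 := by
  rw [PiLp.inner_apply]
  refine (Finset.sum_le_sum (g := fun _ => B ^ 2) fun i _ => ?_).trans (by simp)
  have h1 := unusedService_nonneg (q := q) (a := a) (s := s) i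
  have h2 := unusedService_le hq ha hs i
  have h3 : |s i| ≤ ‖s‖ := by simpa using PiLp.norm_apply_le s i
  have h4 := le_abs_self (s i)
  have hq' := hq i
  have ha' := ha i
  have hs' := hs i
  simp only [RCLike.inner_apply, conj_trivial]
  rcases le_total (s i) (q i + a i) with h | h
  · have : unusedService q a s i = 0 := by simp [unusedService, h]
    rw [this, zero_mul]
    positivity
  · nlinarith

/-- One-step bound for the squared distance to a convex set `K` in the nonnegative orthant. -/
theorem sq_norm_perpCone_queue_le {K : Set (Vec n)} (hK : IsClosed K) (hne : K.Nonempty)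
    (hK0 : ∀ x ∈ K, ∀ i, 0 ≤ x i) {A B : ℝ} (hq : ∀ i, 0 ≤ q i)
    (ha : ∀ i, 0 ≤ a i ∧ a i ≤ A) (hs : ∀ i, 0 ≤ s i) (hsB : ‖s‖ ≤ B) :
    ‖perpCone K (q + a - s + unusedService q a s)‖ ^ 2 ≤ ‖perpCone K q‖ ^ 2 +
      (2 * (n * B ^ 2) + (n * (|A| + B)) ^ 2) + 2 * inner ℝ (perpCone K q) a
        - 2 * (inner ℝ q s - inner ℝ (nearestPoint K q) s) := by
  have hv := norm_le_mul_of_abs_apply_le (abs_queue_increment_le hq ha hs hsB)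
  set u := unusedService q a s with hu
  set v := a - s + u with hvdef
  have hqv : q + a - s + u = q + v := by rw [hvdef]; abel
  rw [hqv]
  have h1 : ‖perpCone K (q + v)‖ ^ 2 ≤ ‖perpCone K q + v‖ ^ 2 :=
    pow_le_pow_left₀ (norm_nonneg _) (norm_perpCone_add_le hK hne q v) 2
  have h2 : ‖v‖ ^ 2 ≤ (n * (|A| + B)) ^ 2 := pow_le_pow_left₀ (norm_nonneg _) hv 2
  rw [norm_add_sq_real] at h1
  have h3 : inner ℝ (perpCone K q) v = inner ℝ (perpCone K q) a
      - (inner ℝ q s - inner ℝ (nearestPoint K q) s)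
      + (inner ℝ q u - inner ℝ (nearestPoint K q) u) := by
    rw [hvdef, inner_add_right, inner_sub_right]
    simp only [perpCone, inner_sub_left]
  have h4 : inner ℝ q u ≤ n * B ^ 2 := inner_unusedService_le hq (fun i => (ha i).1) hs hsB
  -- Here `K` lying in the orthant matters: unused service can be dropped along the projection.
  have h5 : 0 ≤ inner ℝ (nearestPoint K q) u := by
    rw [PiLp.inner_apply]
    refine Finset.sum_nonneg fun i _ => ?_
    simpa using mul_nonneg (unusedService_nonneg i)
      (hK0 _ (nearestPoint_spec hK hne q).1 i)
  linarith

end OneStep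

/-! ### Drift of the distance to a cone under MaxWeight. -/

namespace IsMaxWeightSwitch

variable {n : ℕ} {𝓜 : Type*} [Fintype 𝓜] [MeasurableSpace 𝓜]
  {sw : GeneralizedSwitch n 𝓜} {Amax : ℝ} {lam : Vec n}
  {Ω : Type*} [mΩ : MeasurableSpace Ω] {μ : Measure Ω} {ℱ : Filtration ℕ mΩ}
  {q a s : ℕ → Ω → Vec n} {ch : ℕ → Ω → 𝓜}

theorem ae_arrival_mem (h : IsMaxWeightSwitch sw Amax lam μ ℱ q a s ch) (k : ℕ) :
    ∀ᵐ ω ∂μ, ∀ i, 0 ≤ a k ω i ∧ a k ω i ≤ Amax := by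
  refine (h.identDistrib_a k).symm.ae_snd (p := fun x => ∀ i, 0 ≤ x i ∧ x i ≤ Amax) ?_ h.bounded_a
  refine IsClosed.measurableSet ?_
  simp only [Set.ofPred_forall, Set.ofPred_and]
  exact isClosed_iInter fun i => (isClosed_le continuous_const (by fun_prop)).inter
    (isClosed_le (by fun_prop) continuous_const)

theorem ae_queue_nonneg (h : IsMaxWeightSwitch sw Amax lam μ ℱ q a s ch) (k : ℕ) :
    ∀ᵐ ω ∂μ, ∀ i, 0 ≤ q k ω i := by
  cases k with
  | zero => exact h.q_zero_nonneg
  | succ k =>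
    filter_upwards [h.dynamics k] with ω hω
    rw [hω]
    exact fun i => queue_nonneg i

theorem integral_arrival (h : IsMaxWeightSwitch sw Amax lam μ ℱ q a s ch) (k : ℕ) (i : Fin n) :
    ∫ ω, a k ω i ∂μ = lam i := by
  rw [← h.mean_a i]
  exact ((h.identDistrib_a k).comp (u := fun x : Vec n => x i) (by fun_prop)).integral_eq

theorem ae_abs_norm_perpCone_sub_le (h : IsMaxWeightSwitch sw Amax lam μ ℱ q a s ch) {B : ℝ}
    (hB : ∀ m, ∀ x ∈ sw.S m, ‖x‖ ≤ B) {K : Set (Vec n)} (hK : IsClosed K) (hne : K.Nonempty)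
    (k : ℕ) :
    ∀ᵐ ω ∂μ, |‖perpCone K (q (k + 1) ω)‖ - ‖perpCone K (q k ω)‖| ≤ n * (|Amax| + B) := by
  filter_upwards [h.dynamics k, h.ae_arrival_mem k, h.ae_queue_nonneg k, h.maxWeight k]
    with ω h1 h2 h3 h4
  have h5 := norm_le_mul_of_abs_apply_le
    (abs_queue_increment_le h3 h2 (sw.S_nonneg _ _ h4.1) (hB _ _ h4.1))
  have h6 : q (k + 1) ω = q k ω + (a k ω - s k ω + unusedService (q k ω) (a k ω) (s k ω)) := by
    rw [h1]
    abel
  rw [h6]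
  exact (abs_norm_perpCone_add_sub_le hK hne _ _).trans h5

theorem ae_sq_norm_perpCone_le (h : IsMaxWeightSwitch sw Amax lam μ ℱ q a s ch) {B : ℝ}
    (hB : ∀ m, ∀ x ∈ sw.S m, ‖x‖ ≤ B) {K : Set (Vec n)} (hK : IsClosed K) (hne : K.Nonempty)
    (hK0 : ∀ x ∈ K, ∀ i, 0 ≤ x i) (k : ℕ) :
    ∀ᵐ ω ∂μ, ‖perpCone K (q (k + 1) ω)‖ ^ 2 ≤ ‖perpCone K (q k ω)‖ ^ 2 +
      (2 * (n * B ^ 2) + (n * (|Amax| + B)) ^ 2) + 2 * inner ℝ (perpCone K (q k ω)) (a k ω)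
        - 2 * (sw.support (ch k ω) (q k ω) -
          sw.support (ch k ω) (nearestPoint K (q k ω))) := by
  filter_upwards [h.dynamics k, h.ae_arrival_mem k, h.ae_queue_nonneg k, h.maxWeight k]
    with ω h1 h2 h3 h4
  have h5 := sq_norm_perpCone_queue_le hK hne hK0 h3 h2 (sw.S_nonneg _ _ h4.1) (hB _ _ h4.1)
  -- Passing to support functions eliminates `s`, and with it the tie-breaking: only the channel
  -- state remains random given `q`.
  have h6 := sw.inner_le_support h4.1 (nearestPoint K (q k ω))
  obtain ⟨y, hy, h7⟩ := sw.exists_inner_eq_support (ch k ω) (q k ω)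
  have h8 := h4.2 y hy
  rw [h1]
  linarith

theorem integral_mul_comp (h : IsMaxWeightSwitch sw Amax lam μ ℱ q a s ch) (k : ℕ)
    {G : Ω → ℝ} (hG : Measurable[ℱ k] G) {f : Vec n × 𝓜 → ℝ} (hf : Measurable f) :
    ∫ ω, G ω * f (a k ω, ch k ω) ∂μ = (∫ ω, G ω ∂μ) * ∫ ω, f (a k ω, ch k ω) ∂μ := by
  have ha : Measurable (a k) := (h.measurable_a k).mono (ℱ.le _) le_rfl
  have hch : Measurable (ch k) := (h.measurable_ch k).mono (ℱ.le _) le_rfl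
  have hind : IndepFun G (fun ω => f (a k ω, ch k ω)) μ := by
    rw [IndepFun_iff_Indep]
    refine indep_of_indep_of_le_left (indep_of_indep_of_le_right (h.indep k).symm ?_) hG.comap_le
    rw [show (fun ω => f (a k ω, ch k ω)) = f ∘ fun ω => (a k ω, ch k ω) from rfl,
      ← MeasurableSpace.comap_comp]
    exact MeasurableSpace.comap_mono hf.comap_le
  exact hind.integral_fun_mul_eq_mul_integral (hG.mono (ℱ.le k) le_rfl).aestronglyMeasurable
    (hf.comp (ha.prodMk hch)).aestronglyMeasurable

variable [MeasurableSingletonClass 𝓜] [IsProbabilityMeasure μ]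

/-- Negative drift of the distance of the queue lengths to a convex set `K`. -/
theorem integral_mul_norm_perpCone_sub_le (h : IsMaxWeightSwitch sw Amax lam μ ℱ q a s ch)
    {B : ℝ} (hB : ∀ m, ∀ x ∈ sw.S m, ‖x‖ ≤ B) {K : Set (Vec n)} (hK : IsClosed K)
    (hne : K.Nonempty) (hconv : Convex ℝ K) (hK0 : ∀ x ∈ K, ∀ i, 0 ≤ x i)
    {η κ : ℝ} (hκ : 0 < κ)
    (hκη : 2 * (n * B ^ 2) + (n * (|Amax| + B)) ^ 2 ≤ η * κ)
    (hneg : ∀ x : Vec n, (∀ i, 0 ≤ x i) →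
      inner ℝ (perpCone K x) lam - ∑ m, sw.psi m * sw.support m x +
        ∑ m, sw.psi m * sw.support m (nearestPoint K x) ≤ -η * ‖perpCone K x‖)
    (k : ℕ) {g : Ω → ℝ} {C : ℝ} (hg : Measurable[ℱ k] g) (hg0 : ∀ ω, 0 ≤ g ω)
    (hgC : ∀ᵐ ω ∂μ, g ω ≤ C) (hgκ : ∀ ω, g ω ≠ 0 → κ < ‖perpCone K (q k ω)‖) :
    ∫ ω, g ω * (‖perpCone K (q (k + 1) ω)‖ - ‖perpCone K (q k ω)‖) ∂μ ≤
      -(η / 2) * ∫ ω, g ω ∂μ := by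
  set K1 : ℝ := 2 * (n * B ^ 2) + (n * (|Amax| + B)) ^ 2 with hK1
  have hη0 : 0 ≤ η := by
    have : 0 ≤ K1 := by positivity
    by_contra! hη
    nlinarith
  have hmq : Measurable[ℱ k] (q k) := h.measurable_q k
  have hch : Measurable (ch k) := (h.measurable_ch k).mono (ℱ.le _) le_rfl
  set w : Ω → Vec n := fun ω => perpCone K (q k ω) with hw
  have hwm : Measurable[ℱ k] w := (continuous_perpCone hK hne hconv).measurable.comp hmq
  have hnwm : Measurable[ℱ k] fun ω => ‖w ω‖ := measurable_norm.comp hwm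
  have hwi : ∀ i, Measurable[ℱ k] fun ω => w ω i := fun i =>
    (by fun_prop : Measurable fun x : Vec n => x i).comp hwm
  set d : 𝓜 → Ω → ℝ := fun m ω =>
    sw.support m (q k ω) - sw.support m (nearestPoint K (q k ω)) with hd
  have hdm : ∀ m, Measurable[ℱ k] (d m) := fun m =>
    ((sw.continuous_support m).measurable.comp hmq).sub
      (((sw.continuous_support m).comp (continuous_nearestPoint hK hne hconv)).measurable.comp hmq)
  have hdB : ∀ m ω, |d m ω| ≤ ‖w ω‖ * B := fun m ω => sw.abs_support_sub_le hB m _ _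
  -- This weight converts drift of the square into drift of the norm, through `2y(x - y) ≤ x ^ 2 - y
  -- ^ 2`. Division is harmless since `‖w‖ > κ` wherever `g ≠ 0`.
  set g' : Ω → ℝ := fun ω => g ω / (2 * ‖w ω‖) with hg'
  have hg'm : Measurable[ℱ k] g' := hg.div (hnwm.const_mul 2)
  have hg'0 : ∀ ω, 0 ≤ g' ω := fun ω => div_nonneg (hg0 ω) (by positivity)
  have hg'w : ∀ ω, g' ω * ‖w ω‖ = g ω / 2 := by
    intro ω
    by_cases hgω : g ω = 0
    · simp [hg', hgω]
    · have : 0 < ‖w ω‖ := hκ.trans (hgκ ω hgω)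
      simp only [hg']
      field_simp
  have hg'κ : ∀ ω, g' ω * κ ≤ g ω / 2 := by
    intro ω
    by_cases hgω : g ω = 0
    · simp [hg', hgω]
    · rw [← hg'w]
      exact mul_le_mul_of_nonneg_left (hgκ ω hgω).le (hg'0 ω)
  have hint : ∀ {F : Ω → ℝ} {c : ℝ}, Measurable[ℱ k] F → (∀ ω, |F ω| ≤ c * g ω) →
      Integrable F μ := by
    intro F c hF hFc
    refine Integrable.of_bound (hF.mono (ℱ.le k) le_rfl).aestronglyMeasurable (|c| * C) ?_
    filter_upwards [hgC] with ω hω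
    refine (hFc ω).trans ((mul_le_mul_of_nonneg_right (le_abs_self c) (hg0 ω)).trans ?_)
    exact mul_le_mul_of_nonneg_left hω (abs_nonneg c)
  have hgi : Integrable g μ := hint (c := 1) hg fun ω => by rw [abs_of_nonneg (hg0 ω), one_mul]
  have hg'i : Integrable g' μ := hint (c := 1 / (2 * κ)) hg'm fun ω => by
    rw [abs_of_nonneg (hg'0 ω), div_mul_eq_mul_div, one_mul, le_div_iff₀ (by positivity)]
    linarith [hg'κ ω]
  have hgwi : ∀ i, Integrable (fun ω => g' ω * w ω i) μ := fun i =>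
    hint (c := 1 / 2) (hg'm.mul (hwi i)) fun ω => by
      rw [abs_mul, abs_of_nonneg (hg'0 ω)]
      have h1 : |w ω i| ≤ ‖w ω‖ := by simpa using PiLp.norm_apply_le (w ω) i
      have := mul_le_mul_of_nonneg_left h1 (hg'0 ω)
      rw [hg'w] at this
      linarith
  have hgdi : ∀ m, Integrable (fun ω => g' ω * d m ω) μ := fun m =>
    hint (c := B / 2) (hg'm.mul (hdm m)) fun ω => by
      rw [abs_mul, abs_of_nonneg (hg'0 ω)]
      have := mul_le_mul_of_nonneg_left (hdB m ω) (hg'0 ω)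
      rw [← mul_assoc, hg'w] at this
      linarith
  have hinda : ∀ i, ∫ ω, g' ω * w ω i * a k ω i ∂μ = (∫ ω, g' ω * w ω i ∂μ) * lam i := fun i => by
    rw [← h.integral_arrival k i]
    exact h.integral_mul_comp k (hg'm.mul (hwi i)) (f := fun x => x.1 i) (by fun_prop)
  -- Splitting by channel state separates the history factor `d m` from the independent indicator.
  have hindc : ∀ m, ∫ ω, g' ω * d m ω * ({m} : Set 𝓜).indicator 1 (ch k ω) ∂μ =
      (∫ ω, g' ω * d m ω ∂μ) * sw.psi m := fun m => by
    have h1 : ∫ ω, ({m} : Set 𝓜).indicator (1 : 𝓜 → ℝ) (ch k ω) ∂μ = sw.psi m := by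
      rw [← h.law_ch k m]
      exact integral_indicator_one (hch (measurableSet_singleton m))
    rw [← h1]
    exact h.integral_mul_comp k (hg'm.mul (hdm m))
      (f := fun x => ({m} : Set 𝓜).indicator 1 x.2)
      ((measurable_one.indicator (measurableSet_singleton m)).comp measurable_snd)
  have hai : ∀ i, Integrable (fun ω => g' ω * w ω i * a k ω i) μ := fun i => by
    refine (hgwi i).mul_bdd (c := Amax) ?_ ?_
    · exact (((by fun_prop : Measurable fun x : Vec n => x i).comp
        ((h.measurable_a k).mono (ℱ.le _) le_rfl))).aestronglyMeasurable
    · filter_upwards [h.ae_arrival_mem k] with ω hω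
      rw [Real.norm_of_nonneg (hω i).1]
      exact (hω i).2
  have hci : ∀ m, Integrable
      (fun ω => g' ω * d m ω * ({m} : Set 𝓜).indicator 1 (ch k ω)) μ := fun m => by
    refine (hgdi m).mul_bdd (c := 1) ?_ (ae_of_all _ fun ω => ?_)
    · exact ((measurable_one.indicator (measurableSet_singleton m)).comp hch).aestronglyMeasurable
    · by_cases hm : ch k ω = m <;> simp [Set.indicator, hm]
  have hpt : ∀ᵐ ω ∂μ, g ω * (‖perpCone K (q (k + 1) ω)‖ - ‖w ω‖) ≤
      K1 * g' ω + 2 * ∑ i, g' ω * w ω i * a k ω i -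
        2 * ∑ m, g' ω * d m ω * ({m} : Set 𝓜).indicator 1 (ch k ω) := by
    filter_upwards [h.ae_sq_norm_perpCone_le hB hK hne hK0 k] with ω hω
    have h1 : ∑ i, g' ω * w ω i * a k ω i = g' ω * inner ℝ (w ω) (a k ω) := by
      rw [PiLp.inner_apply, Finset.mul_sum]
      exact Finset.sum_congr rfl fun i _ => by simp; ring
    have h2 : ∑ m, g' ω * d m ω * ({m} : Set 𝓜).indicator 1 (ch k ω) = g' ω * d (ch k ω) ω := by
      rw [Finset.sum_eq_single (ch k ω)]
      · simp
      · intro m _ hm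
        simp [Ne.symm hm]
      · simp
    rw [h1, h2]
    have h3 : g ω = g' ω * (2 * ‖w ω‖) := by linarith [hg'w ω]
    have h4 : 2 * ‖w ω‖ * (‖perpCone K (q (k + 1) ω)‖ - ‖w ω‖) ≤
        K1 + 2 * inner ℝ (w ω) (a k ω) - 2 * d (ch k ω) ω := by
      have := sq_nonneg (‖perpCone K (q (k + 1) ω)‖ - ‖w ω‖)
      simp only [hw, hd] at this ⊢
      nlinarith
    have h5 := mul_le_mul_of_nonneg_left h4 (hg'0 ω)
    rw [h3]
    linarith
  have hinc : Integrable (fun ω => g ω * (‖perpCone K (q (k + 1) ω)‖ - ‖w ω‖)) μ := by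
    refine hgi.mul_bdd (c := n * (|Amax| + B)) ?_ (h.ae_abs_norm_perpCone_sub_le hB hK hne k)
    refine Measurable.aestronglyMeasurable (Measurable.sub ?_ (hnwm.mono (ℱ.le k) le_rfl))
    exact ((continuous_perpCone hK hne hconv).norm.measurable.comp (h.measurable_q (k + 1))).mono
      (ℱ.le _) le_rfl
  have hsa := integrable_finsetSum Finset.univ fun i _ => hai i
  have hsc := integrable_finsetSum Finset.univ fun m _ => hci m
  have hsa' := integrable_finsetSum Finset.univ fun i _ => (hgwi i).mul_const (lam i)
  have hsc' := integrable_finsetSum Finset.univ fun m _ => (hgdi m).mul_const (sw.psi m)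
  have hle := integral_mono_ae hinc
    (((hg'i.const_mul K1).fun_add (hsa.const_mul 2)).sub (hsc.const_mul 2)) hpt
  have heq : ∫ ω, (K1 * g' ω + 2 * ∑ i, g' ω * w ω i * a k ω i -
        2 * ∑ m, g' ω * d m ω * ({m} : Set 𝓜).indicator 1 (ch k ω)) ∂μ =
      ∫ ω, (K1 * g' ω + 2 * ∑ i, g' ω * w ω i * lam i -
        2 * ∑ m, g' ω * d m ω * sw.psi m) ∂μ := by
    rw [integral_sub ((hg'i.const_mul K1).fun_add (hsa.const_mul 2)) (hsc.const_mul 2),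
      integral_add (hg'i.const_mul K1) (hsa.const_mul 2),
      integral_sub ((hg'i.const_mul K1).fun_add (hsa'.const_mul 2)) (hsc'.const_mul 2),
      integral_add (hg'i.const_mul K1) (hsa'.const_mul 2)]
    simp only [integral_const_mul]
    rw [integral_finsetSum _ fun i _ => hai i, integral_finsetSum _ fun m _ => hci m,
      integral_finsetSum _ fun i _ => (hgwi i).mul_const (lam i),
      integral_finsetSum _ fun m _ => (hgdi m).mul_const (sw.psi m)]
    simp only [hinda, hindc, integral_mul_const]
  refine hle.trans (heq.le.trans ?_)
  rw [← integral_const_mul]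
  refine integral_mono_ae
    (((hg'i.const_mul K1).fun_add (hsa'.const_mul 2)).sub (hsc'.const_mul 2))
    (hgi.const_mul _) ?_
  filter_upwards [h.ae_queue_nonneg k] with ω hω
  have h1 : ∑ i, g' ω * w ω i * lam i = g' ω * inner ℝ (w ω) lam := by
    rw [PiLp.inner_apply, Finset.mul_sum]
    exact Finset.sum_congr rfl fun i _ => by simp; ring
  have h2 : ∑ m, g' ω * d m ω * sw.psi m = g' ω * (∑ m, sw.psi m * sw.support m (q k ω) -
      ∑ m, sw.psi m * sw.support m (nearestPoint K (q k ω))) := by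
    rw [← Finset.sum_sub_distrib, Finset.mul_sum]
    exact Finset.sum_congr rfl fun m _ => by simp only [hd]; ring
  simp only [h1, h2]
  have h3 := mul_le_mul_of_nonneg_left (hneg _ hω) (hg'0 ω)
  have h4 := hg'w ω
  -- Above `κ` the constant term costs at most half of the drift `η`, leaving `η / 2`.
  have h5 : K1 * g' ω ≤ η * (g ω / 2) :=
    calc K1 * g' ω ≤ η * κ * g' ω := mul_le_mul_of_nonneg_right hκη (hg'0 ω)
      _ = η * (g' ω * κ) := by ring
      _ ≤ η * (g ω / 2) := mul_le_mul_of_nonneg_left (hg'κ ω) hη0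
  have h6 : g' ω * (-η * ‖w ω‖) = -η * (g ω / 2) := by rw [← h4]; ring
  simp only [hw] at h3 h6 ⊢
  linarith

end IsMaxWeightSwitch

/-- The constant in the bound on the `t`-th moment of a process with drift at most `-η` above the
level `κ` and increments at most `D`. -/
noncomputable def momentBound (D η κ : ℝ) (t : ℕ) : ℝ :=
  t.factorial / driftExponent D η ^ t *
    (Real.exp (driftExponent D η * κ + 1) / (driftExponent D η * η / 2))

theorem IsMaxWeightSwitch.integral_norm_perpCone_pow_le {n : ℕ} {𝓜 : Type*} [Fintype 𝓜]
    [MeasurableSpace 𝓜] [MeasurableSingletonClass 𝓜] {sw : GeneralizedSwitch n 𝓜} {Amax : ℝ}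
    {lam : Vec n} {Ω : Type*} [mΩ : MeasurableSpace Ω] {μ : Measure Ω} [IsProbabilityMeasure μ]
    {ℱ : Filtration ℕ mΩ} {q a s : ℕ → Ω → Vec n} {ch : ℕ → Ω → 𝓜}
    (h : IsMaxWeightSwitch sw Amax lam μ ℱ q a s ch)
    {B : ℝ} (hB0 : 0 ≤ B) (hB : ∀ m, ∀ x ∈ sw.S m, ‖x‖ ≤ B) {K : Set (Vec n)}
    (hK : IsClosed K) (hne : K.Nonempty) (hconv : Convex ℝ K) (hK0 : ∀ x ∈ K, ∀ i, 0 ≤ x i)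
    {η : ℝ} (hη : 0 < η)
    (hneg : ∀ x : Vec n, (∀ i, 0 ≤ x i) →
      inner ℝ (perpCone K x) lam - ∑ m, sw.psi m * sw.support m x +
        ∑ m, sw.psi m * sw.support m (nearestPoint K x) ≤ -η * ‖perpCone K x‖)
    {Ω' : Type*} [MeasurableSpace Ω'] {μ' : Measure Ω'} [IsProbabilityMeasure μ']
    {qbar : Ω' → Vec n} (hlim : TendstoInDistribution q atTop qbar (fun _ => μ) μ') (t : ℕ) :
    Integrable (fun ω => ‖perpCone K (qbar ω)‖ ^ t) μ' ∧
      ∫ ω, ‖perpCone K (qbar ω)‖ ^ t ∂μ' ≤ momentBound (n * (|Amax| + B) + 1) (η / 2)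
        ((2 * (n * B ^ 2) + (n * (|Amax| + B)) ^ 2) / η + 1) t := by
  -- The added ones in the increment bound and the level keep both positive in degenerate cases.
  refine integral_pow_le_of_tendstoInDistribution (ℱ := ℱ) (V := fun x => ‖perpCone K x‖)
    (by positivity) (by positivity) (continuous_perpCone hK hne hconv).norm
    (fun x => norm_nonneg _) h.measurable_q (fun k => ?_)
    (fun k g C hg hg0 hgC hgκ => ?_) hlim t
  · filter_upwards [h.ae_abs_norm_perpCone_sub_le hB hK hne k] with ω hω
    linarith
  · refine h.integral_mul_norm_perpCone_sub_le hB hK hne hconv hK0 (by positivity) ?_ hneg k hg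
      hg0 hgC hgκ
    rw [mul_add η, mul_div_cancel₀ _ hη.ne']
    linarith

/-! ### Positivity of `ν` and the collapse bound. -/

theorem isClosed_orthantPolyhedron {n L : ℕ} (c : Fin L → Vec n) (b : Fin L → ℝ) :
    IsClosed (orthantPolyhedron c b) := by
  simp only [orthantPolyhedron, Set.ofPred_forall, Set.ofPred_and]
  exact (isClosed_iInter fun i => isClosed_le continuous_const (by fun_prop)).inter
    (isClosed_iInter fun ℓ => isClosed_le (by fun_prop) continuous_const)

theorem pos_of_mem_interior {n : ℕ} {C : Set (Vec n)} (hC : ∀ x ∈ C, ∀ i, 0 ≤ x i) {x : Vec n}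
    (hx : x ∈ interior C) (i : Fin n) : 0 < x i := by
  rw [mem_interior_iff_mem_nhds, Metric.mem_nhds_iff] at hx
  obtain ⟨r, hr, hsub⟩ := hx
  have hmem : x - (r / 2) • EuclideanSpace.single i (1 : ℝ) ∈ C := by
    refine hsub ?_
    rw [Metric.mem_ball, dist_eq_norm, sub_sub_cancel_left, norm_neg, norm_smul,
      PiLp.norm_single, Real.norm_of_nonneg (by positivity)]
    simp only [norm_one, mul_one]
    linarith
  have := hC _ hmem i
  simp at this
  linarith

theorem exists_pos_forall_le {ι : Type*} [Finite ι] {f : ι → ℝ} (hf : ∀ i, 0 < f i) :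
    ∃ r, 0 < r ∧ ∀ i, r ≤ f i := by
  rcases isEmpty_or_nonempty ι with hι | hι
  · exact ⟨1, one_pos, fun i => (hι.false i).elim⟩
  · obtain ⟨i, hi⟩ := Finite.exists_min f
    exact ⟨f i, hf i, hi⟩

theorem mul_norm_le_inner {n : ℕ} {x ν : Vec n} {r : ℝ} (hr : 0 ≤ r) (hx : ∀ i, 0 ≤ x i)
    (hν : ∀ i, r ≤ ν i) : r * ‖x‖ ≤ inner ℝ x ν := by
  have h : ‖x‖ ≤ ∑ i, x i := by
    conv_lhs => rw [← (EuclideanSpace.basisFun (Fin n) ℝ).sum_repr x]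
    refine (norm_sum_le _ _).trans (Finset.sum_le_sum fun i _ => ?_)
    simp [norm_smul, abs_of_nonneg (hx i)]
  refine (mul_le_mul_of_nonneg_left h hr).trans ?_
  rw [PiLp.inner_apply, Finset.mul_sum]
  refine Finset.sum_le_sum fun i _ => ?_
  simpa using mul_le_mul_of_nonneg_right (hν i) (hx i)

theorem proposition2 {n L : ℕ} {𝓜 : Type*} [Fintype 𝓜] [MeasurableSpace 𝓜]
    [MeasurableSingletonClass 𝓜] (sw : GeneralizedSwitch n 𝓜)
    (c : Fin L → Vec n) (b : Fin L → ℝ)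
    (hcb : IsFacetDescription sw.capacityRegion c b)
    (ν : Vec n) (hν : ν ∈ frontier sw.capacityRegion)
    (hint : ∀ ε ∈ Set.Ioo (0 : ℝ) 1, (1 - ε) • ν ∈ interior sw.capacityRegion)
    (P : Set (Fin L)) (hP : P = activeFacets sw.capacityRegion c b ν)
    (δ : ℝ) (hδ_pos : 0 < δ)
    (hδ : ∀ ℓ, ℓ ∉ P → δ ≤ b ℓ - inner ℝ (c ℓ) ν)
    (hδ_one : (∀ ℓ, ℓ ∈ P) → δ = 1)
    (Amax : ℝ) (t : ℕ) (ht : 1 ≤ t) :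
    ∃ T : ℝ, ∀ ε ∈ Set.Ioo (0 : ℝ) 1, ε < δ / (2 * ‖ν‖) →
      ∀ (Ω : Type*) [mΩ : MeasurableSpace Ω] (μ : Measure Ω) [IsProbabilityMeasure μ]
        (ℱ : Filtration ℕ mΩ) (q a s : ℕ → Ω → Vec n) (ch : ℕ → Ω → 𝓜),
        IsMaxWeightSwitch sw Amax ((1 - ε) • ν) μ ℱ q a s ch →
      ∀ (Ω' : Type*) [MeasurableSpace Ω'] (μ' : Measure Ω') [IsProbabilityMeasure μ']
        (qbar : Ω' → Vec n),
        TendstoInDistribution q atTop qbar (fun _ => μ) μ' →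
        Integrable (fun ω => ‖perpSpace (collapseSpace c P) (qbar ω)‖ ^ t) μ' ∧
        Integrable (fun ω => ‖perpCone (collapseCone c P) (qbar ω)‖ ^ t) μ' ∧
        ∫ ω, ‖perpSpace (collapseSpace c P) (qbar ω)‖ ^ t ∂μ' ≤
          ∫ ω, ‖perpCone (collapseCone c P) (qbar ω)‖ ^ t ∂μ' ∧
        ∫ ω, ‖perpCone (collapseCone c P) (qbar ω)‖ ^ t ∂μ' ≤ T := by
  subst hP
  have hνC : ν ∈ sw.capacityRegion := by
    have hclosed : IsClosed sw.capacityRegion := by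
      rw [hcb.eq_polyhedron]
      exact isClosed_orthantPolyhedron c b
    exact hclosed.frontier_subset hν
  have hC0 : ∀ x ∈ sw.capacityRegion, ∀ i, 0 ≤ x i := by
    rw [hcb.eq_polyhedron]
    exact fun x hx => hx.1
  have hνpos : ∀ i, 0 < ν i := fun i => by
    have := pos_of_mem_interior hC0 (hint (1 / 2) ⟨by norm_num, by norm_num⟩) i
    simp only [PiLp.smul_apply, smul_eq_mul] at this
    linarith
  obtain ⟨r₀, hr₀, hr₀ν⟩ := exists_pos_forall_le hνpos
  obtain ⟨r, hr, hrδ, hrr₀⟩ : ∃ r, 0 < r ∧ r ≤ δ ∧ r ≤ r₀ :=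
    ⟨min δ r₀, lt_min hδ_pos hr₀, min_le_left _ _, min_le_right _ _⟩
  have hrν : ∀ i, r ≤ ν i := fun i => hrr₀.trans (hr₀ν i)
  obtain ⟨B, hB0, hB⟩ := sw.exists_norm_le
  set P := activeFacets sw.capacityRegion c b ν with hP
  set K := collapseCone c P with hKdef
  set H := collapseSpace c P
  have hK : IsClosed K := collapseCone_isClosed c P hcb.c_nonneg hcb.c_norm
  have hne : K.Nonempty := collapseCone_nonempty c P
  have h0K : (0 : Vec n) ∈ K := ⟨fun _ => le_rfl, 0, fun _ => le_rfl, fun _ _ => rfl, by simp⟩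
  have hconv : Convex ℝ K := collapseCone_convex c P
  set T : ℝ → ℝ := fun η => momentBound (n * (|Amax| + B) + 1) (η / 2)
    ((2 * (n * B ^ 2) + (n * (|Amax| + B)) ^ 2) / η + 1) t
  refine ⟨max (T (r / 2)) (T (r / (2 * ‖ν‖) * r)), ?_⟩
  intro ε hε _ Ω mΩ μ _ ℱ q a s ch h Ω' _ μ' _ qbar hlim
  have hqbar := hlim.aemeasurable_limit
  have hmeasK : AEStronglyMeasurable (fun ω => ‖perpCone K (qbar ω)‖ ^ t) μ' :=
    (((continuous_perpCone hK hne hconv).norm.pow t).measurable.comp_aemeasurable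
      hqbar).aestronglyMeasurable
  have hmeasH : AEStronglyMeasurable (fun ω => ‖perpSpace H (qbar ω)‖ ^ t) μ' := by
    have hcont : Continuous fun x : Vec n => ‖perpSpace H x‖ ^ t :=
      (continuous_id.sub H.starProjection.continuous).norm.pow t
    exact (hcont.measurable.comp_aemeasurable hqbar).aestronglyMeasurable
  have hHK : ∀ x, ‖perpSpace H x‖ ^ t ≤ ‖perpCone K x‖ ^ t := fun x =>
    pow_le_pow_left₀ (norm_nonneg _) (norm_perpSpace_le_norm_sub H x
      (collapseCone_subset_collapseSpace c P (nearestPoint_spec hK hne x).1)) t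
  have hmain : Integrable (fun ω => ‖perpCone K (qbar ω)‖ ^ t) μ' ∧
      ∫ ω, ‖perpCone K (qbar ω)‖ ^ t ∂μ' ≤ max (T (r / 2)) (T (r / (2 * ‖ν‖) * r)) := by
    -- `r` may be smaller than `δ`, so both regimes can occur; the maximum of their bounds does not
    -- depend on `ε`.
    rcases le_or_gt (ε * ‖ν‖) (r / 2) with hsmall | hlarge
    · have hmom := h.integral_norm_perpCone_pow_le hB0 hB hK hne hconv (fun x hx => hx.1)
        (η := r / 2) (by positivity) (fun x _ => ?_) hlim t
      · exact ⟨hmom.1, hmom.2.trans (le_max_left _ _)⟩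
      have h1 := sum_support_le_of_mem_collapseCone hcb (nearestPoint_spec hK hne x).1
      have h2 := le_sum_support_of_perpCone hcb hνC hr.le hrν
        (fun ℓ hℓ => hrδ.trans (hδ ℓ hℓ)) x
      have h3 : inner ℝ x ν = inner ℝ (nearestPoint K x) ν + inner ℝ (perpCone K x) ν := by
        rw [← inner_add_left, nearestPoint_add_perpCone]
      have h4 := (abs_le.1 (abs_real_inner_le_norm (perpCone K x) ν)).1
      have h5 := mul_le_mul_of_nonneg_left h4 hε.1.le
      have h6 := mul_le_mul_of_nonneg_left hsmall (norm_nonneg (perpCone K x))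
      rw [inner_smul_right]
      linarith
    · have hν0 : 0 < ‖ν‖ := by
        refine (norm_nonneg ν).lt_of_ne fun h0 => ?_
        rw [← h0, mul_zero] at hlarge
        linarith
      -- With the trivial cone the drift is at most `-ε * ⟨x, ν⟩ ≤ -ε * r * ‖x‖`, and `ε` exceeds `r
      -- / (2 * ‖ν‖)`.
      have hmom := h.integral_norm_perpCone_pow_le hB0 hB (K := {0}) isClosed_singleton
        (Set.singleton_nonempty _) (convex_singleton _)
        (fun x hx i => by rw [Set.mem_singleton_iff.1 hx]; exact le_rfl)
        (η := r / (2 * ‖ν‖) * r) (by positivity) (fun x hx => ?_) hlim t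
      · simp only [perpCone_singleton_zero] at hmom
        have hle : ∀ x : Vec n, ‖perpCone K x‖ ^ t ≤ ‖x‖ ^ t := fun x =>
          pow_le_pow_left₀ (norm_nonneg _) (norm_perpCone_le_norm hK h0K x) t
        have hi := hmom.1.mono' hmeasK (ae_of_all _ fun ω => by
          rw [Real.norm_of_nonneg (by positivity)]
          exact hle _)
        exact ⟨hi, (integral_mono hi hmom.1 fun ω => hle _).trans
          (hmom.2.trans (le_max_right _ _))⟩
      have hp : nearestPoint ({0} : Set (Vec n)) x = 0 :=
        (nearestPoint_spec isClosed_singleton (Set.singleton_nonempty _) x).1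
      obtain ⟨y, _, hy⟩ := sw.exists_sum_support_eq (0 : Vec n)
      rw [inner_zero_left] at hy
      rw [perpCone_singleton_zero, hp, hy, inner_smul_right]
      have h1 := sw.inner_le_sum_support hνC x
      have h2 := mul_norm_le_inner hr.le hx hrν
      have h3 : r / (2 * ‖ν‖) ≤ ε := by
        rw [div_le_iff₀ (by positivity)]
        linarith
      have h4 : r / (2 * ‖ν‖) * (r * ‖x‖) ≤ ε * inner ℝ x ν :=
        mul_le_mul h3 h2 (by positivity) hε.1.le
      linarith
  have hHint : Integrable (fun ω => ‖perpSpace H (qbar ω)‖ ^ t) μ' :=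
    hmain.1.mono' hmeasH (ae_of_all _ fun ω => by
      rw [Real.norm_of_nonneg (by positivity)]
      exact hHK _)
  exact ⟨hHint, hmain.1, integral_mono hHint hmain.1 fun ω => hHK _, hmain.2⟩
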